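/- Let $(M,\omega)$ be a symplectic manifold of dimension $2d$ (a smooth Hausdorff second countable manifold with a smooth closed non-degenerate 2-form $\omega$), and let $\mathrm{dist}$ be the distance of a (continuous) Riemannian metric on $M$, infinite between points of different components. Let $1\le r\le\infty$ and let $f:M\to M$ be a $C^r$ diffeomorphism such that $f^*\omega=a\,\omega$ for some $a\in(0,1)$. Let $x\in M$ and $m\ge 1$ with $f^m(x)=x$, let $\mathrm{Spec}(Df^m(x))\subset\mathbb C$ be the set of complex eigenvalues of $Df^m(x):T_xM\to T_xM$, and put $$\Lambda_-=\{\lambda\in \mathrm{Spec}(Df^m(x)) : |\lambda|<\sqrt{a^m}\},\qquad \Lambda_+=\{\lambda\in \mathrm{Spec}(Df^m(x)) : |\lambda|>1\}.$$ Let $b>0$ and $c$ be real numbers with $$|\lambda|<b \ \text{ for all } \lambda\in\Lambda_-,\qquad b<\sqrt{a^m},\qquad 1<c,\qquad c<|\lambda| \ \text{ for all } \lambda\in\Lambda_+ .$$ Then each of the sets $$W^-=\Big\{y\in M:\ \lim_{n\to\infty}\tfrac1{b^n}\,\mathrm{dist}\big(f^{mn}(x),f^{mn}(y)\big)=0\Big\},$$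 $$W^+=\Big\{y\in M:\ \lim_{n\to\infty}c^n\,\mathrm{dist}\big(f^{-mn}(y),f^{-mn}(x)\big)=0\Big\}$$ is an isotropic $C^r$ immersed submanifold of $M$, and $f^m(W^-)=W^-$, $f^m(W^+)=W^+$. Here $W\subset M$ is a $C^r$ immersed submanifold if $W=\iota(N)$ for an injective $C^r$ immersion $\iota$ of a Hausdorff second countable $C^r$ manifold $N$ into $M$, and it is isotropic if $\omega(D\iota(p)u,D\iota(p)v)=0$ for all $p\in N$ and $u,v\in T_pN$. -/

import Mathlib

open scoped Manifold ContDiff Topology Bundle TensorProduct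

noncomputable section

namespace ConformallySymplectic

universe u

section Forms

variable {d : ℕ} {M : Type u} [TopologicalSpace M] [ChartedSpace (EuclideanSpace ℝ (Fin (2 * d))) M]

/-- The expression in the chart at `p` of a field `Ω` of alternating bilinear forms on the tangent
spaces of `M`: its pull-back by the inverse of the chart (meaningful on the target of the chart). -/
def chartForm (Ω : ∀ x : M, TangentSpace (𝓡 (2 * d)) x [⋀^Fin 2]→L[ℝ] ℝ) (p : M) :
    EuclideanSpace ℝ (Fin (2 * d)) → EuclideanSpace ℝ (Fin (2 * d)) [⋀^Fin 2]→L[ℝ] ℝ :=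
  fun y => (Ω ((extChartAt (𝓡 (2 * d)) p).symm y)).compContinuousLinearMap
    (mfderiv 𝓘(ℝ, EuclideanSpace ℝ (Fin (2 * d))) (𝓡 (2 * d)) (extChartAt (𝓡 (2 * d)) p).symm y)

end Forms

/-- A symplectic form on the `2d`-dimensional manifold `M`: a smooth closed non-degenerate
differential 2-form. Smoothness and closedness are read in the charts. -/
structure SymplecticForm (d : ℕ) (M : Type u) [TopologicalSpace M]
    [ChartedSpace (EuclideanSpace ℝ (Fin (2 * d))) M] where
  /-- the alternating bilinear form on each tangent space -/
  form : ∀ x : M, TangentSpace (𝓡 (2 * d)) x [⋀^Fin 2]→L[ℝ] ℝ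
  smooth : ∀ p : M, ContDiffOn ℝ ∞ (chartForm form p) (extChartAt (𝓡 (2 * d)) p).target
  closed : ∀ p : M, ∀ y ∈ (extChartAt (𝓡 (2 * d)) p).target, extDeriv (chartForm form p) y = 0
  nondegenerate : ∀ (x : M) (u : TangentSpace (𝓡 (2 * d)) x),
    (∀ v : TangentSpace (𝓡 (2 * d)) x, form x ![u, v] = 0) → u = 0

section

variable {d : ℕ} {M : Type u} [TopologicalSpace M] [ChartedSpace (EuclideanSpace ℝ (Fin (2 * d))) M]

/-- `f^* Ω = a Ω`. -/
def IsConformal (Ω : SymplecticForm d M) (f : M → M) (a : ℝ) : Prop :=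
  ∀ (x : M) (u v : TangentSpace (𝓡 (2 * d)) x),
    Ω.form (f x) ![mfderiv (𝓡 (2 * d)) (𝓡 (2 * d)) f x u, mfderiv (𝓡 (2 * d)) (𝓡 (2 * d)) f x v]
      = a * Ω.form x ![u, v]

variable (d) in
/-- For a fixed point `x` of `g`, the set of complex eigenvalues of the differential
`Dg(x) : T_x M → T_x M`, that is, the spectrum of its complexification. Every tangent space is the
model space, through the preferred chart at the base point; as `g x = x` the same chart is used
at the source and at the target, so that the differential is an endomorphism. -/
def fixedPointSpectrum (g : M → M) (x : M) : Set ℂ :=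
  let A : EuclideanSpace ℝ (Fin (2 * d)) →L[ℝ] EuclideanSpace ℝ (Fin (2 * d)) :=
    mfderiv (𝓡 (2 * d)) (𝓡 (2 * d)) g x
  spectrum ℂ (LinearMap.baseChange ℂ A.toLinearMap :
    Module.End ℂ (ℂ ⊗[ℝ] EuclideanSpace ℝ (Fin (2 * d))))

variable (d) in
/-- `W` is a `C^r` immersed submanifold of `M` that is isotropic for `Ω`: it is the image of
an injective `C^r` immersion `ι` of a (Hausdorff, second countable) `C^r` manifold `N` of some
dimension `k`, and `Ω` vanishes on all tangent spaces `Dι(p) (T_p N)`. -/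
def IsIsotropicImmersedSubmanifold (Ω : SymplecticForm d M) (r : ℕ∞) (W : Set M) : Prop :=
  ∃ (k : ℕ) (N : Type u) (_ : TopologicalSpace N) (_ : ChartedSpace (EuclideanSpace ℝ (Fin k)) N)
    (ι : N → M),
    T2Space N ∧ SecondCountableTopology N ∧ IsManifold (𝓡 k) r N ∧
    Manifold.IsImmersion (𝓡 k) (𝓡 (2 * d)) r ι ∧ Function.Injective ι ∧ Set.range ι = W ∧
    ∀ (p : N) (u v : TangentSpace (𝓡 k) p),
      Ω.form (ι p) ![mfderiv (𝓡 k) (𝓡 (2 * d)) ι p u, mfderiv (𝓡 k) (𝓡 (2 * d)) ι p v] = 0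

variable [Bundle.RiemannianBundle (fun x : M => TangentSpace (𝓡 (2 * d)) x)]

variable (d) in
/-- `W⁻`: the points `y` with `b⁻ⁿ d(f^{mn} x, f^{mn} y) → 0`, where `d` is the Riemannian
distance (infinite between different components). -/
def strongStableSet (f : M → M) (m : ℕ) (x : M) (b : ℝ) : Set M :=
  {y | Filter.Tendsto (fun n : ℕ => ENNReal.ofReal (1 / b ^ n) *
    Manifold.riemannianEDist (𝓡 (2 * d)) (f^[m * n] x) (f^[m * n] y)) Filter.atTop (𝓝 0)}

variable (d) in
/-- `W⁺`: the points `y` with `cⁿ d(f^{-mn} y, f^{-mn} x) → 0`; the argument `finv` is the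
inverse of the diffeomorphism. -/
def unstableSet (finv : M → M) (m : ℕ) (x : M) (c : ℝ) : Set M :=
  {y | Filter.Tendsto (fun n : ℕ => ENNReal.ofReal (c ^ n) *
    Manifold.riemannianEDist (𝓡 (2 * d)) (finv^[m * n] y) (finv^[m * n] x)) Filter.atTop (𝓝 0)}

end

end ConformallySymplectic

end

/-! Put `g = f^m`, which fixes `x`. Both sets are instances of one object, `fastStableSet`: the
points whose forward orbit under a map fixing `x` converges to `x` faster than `b^n`. For `W⁻` the
map is `g`; for `W⁺` it is the inverse of `g`, with rate `1/c`. The spectral hypotheses serve to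
exclude multipliers of modulus exactly equal to the rate: one of modulus `b` would lie in `Λ₋` and
so be smaller than `b`, and similarly for `c`.

Smoothness comes from solving for whole orbits at once. In a chart centred at `x`, write an orbit as
`b^n ζ_n` with `ζ` a null sequence. The orbit equation becomes `ζ_{n+1} = b^{-n-1} g(b^n ζ_n)`,
which is `C^r` in `ζ` on a ball of the Banach space `C₀(ℕ, F)` (`contDiffOn_rescaled`). Its
linearization at `0` is `S - T`, with `S` the shift and `T = b⁻¹ Dg(x)` applied termwise. As `T` has
no eigenvalue of modulus one, `S - T` is surjective (`surjective_shiftNull_sub_mapNull`); its kernel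
is finite-dimensional. The inverse function theorem then parametrizes the small solutions by an open
set of some `ℝ^k` (`exists_chart_null_orbits`). Comparing Riemannian and chart distances near `x`
shows that every point of the stable set enters this local piece after finitely many steps. The
preimages of the piece under `g^n` therefore exhaust the set, and they are glued to an injectively
immersed manifold by `exists_immersed_union`; the result is `exists_immersion_fastStableSet`.

Isotropy is a comparison of rates. Differentiating the family of orbits shows that `Dg^n u = o(b^n)`
for `u` tangent to the stable set. If `g^*ω = A ω` with `b² < A`, then `A^n ω(u,v) = ω(Dg^n u, Dg^n
v) = o(b^{2n})` forces `ω(u,v) = 0` (`form_eq_zero_of_contracted`). For `W⁻` one has `b² < a^m`, and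
for `W⁺` one has `c⁻² < 1 < a^{-m}`. -/

noncomputable section

namespace ConformallySymplectic

open scoped BoundedContinuousFunction ZeroAtInfty
open Filter Set Metric

/-! ### Null and bounded sequences, and the linear operators acting on them. -/

section Sequences

variable {E F : Type*} [NormedAddCommGroup E]

/-- A null sequence as an element of `C₀(ℕ, E)`. -/
def nullSeq (u : ℕ → E) (hu : Tendsto u atTop (𝓝 0)) : C₀(ℕ, E) where
  toFun := u
  zero_at_infty' := by rwa [cocompact_eq_atTop]

@[simp] lemma nullSeq_apply (u : ℕ → E) (hu : Tendsto u atTop (𝓝 0)) (n : ℕ) :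
    nullSeq u hu n = u n := rfl

lemma tendsto_nullSeq (ζ : C₀(ℕ, E)) : Tendsto ζ atTop (𝓝 0) := by
  have := ζ.zero_at_infty'
  rwa [cocompact_eq_atTop] at this

lemma norm_nullSeq_le {ζ : C₀(ℕ, E)} {C : ℝ} (hC : 0 ≤ C) : ‖ζ‖ ≤ C ↔ ∀ n, ‖ζ n‖ ≤ C := by
  rw [← ZeroAtInftyContinuousMap.norm_toBCF_eq_norm, BoundedContinuousFunction.norm_le hC]
  rfl

lemma norm_apply_le (ζ : C₀(ℕ, E)) (n : ℕ) : ‖ζ n‖ ≤ ‖ζ‖ :=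
  (norm_nullSeq_le (norm_nonneg _)).1 le_rfl n

variable [NormedSpace ℝ E] [NormedAddCommGroup F] [NormedSpace ℝ F]

/-- Evaluation of null sequences at an index. -/
def evalNull (E : Type*) [NormedAddCommGroup E] [NormedSpace ℝ E] (n : ℕ) : C₀(ℕ, E) →L[ℝ] E :=
  LinearMap.mkContinuous
    { toFun := fun ζ => ζ n
      map_add' := fun _ _ => rfl
      map_smul' := fun _ _ => rfl } 1 (fun ζ => by simpa using norm_apply_le ζ n)

@[simp] lemma evalNull_apply (n : ℕ) (ζ : C₀(ℕ, E)) : evalNull E n ζ = ζ n := rfl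

/-- The shift of null sequences. -/
def shiftNull (𝕜 E : Type*) [NontriviallyNormedField 𝕜] [NormedAddCommGroup E] [NormedSpace 𝕜 E] :
    C₀(ℕ, E) →L[𝕜] C₀(ℕ, E) :=
  LinearMap.mkContinuous
    { toFun := fun ζ => nullSeq (fun n => ζ (n + 1)) ((tendsto_nullSeq ζ).comp (tendsto_add_atTop_nat 1))
      map_add' := fun _ _ => rfl
      map_smul' := fun _ _ => rfl } 1 (fun ζ => by
        rw [one_mul, norm_nullSeq_le (norm_nonneg _)]
        exact fun n => norm_apply_le ζ (n + 1))

@[simp] lemma shiftNull_apply {𝕜 E : Type*} [NontriviallyNormedField 𝕜] [NormedAddCommGroup E]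
    [NormedSpace 𝕜 E] (ζ : C₀(ℕ, E)) (n : ℕ) :
    shiftNull 𝕜 E ζ n = ζ (n + 1) := rfl

lemma norm_shiftNull_le {𝕜 E : Type*} [NontriviallyNormedField 𝕜] [NormedAddCommGroup E]
    [NormedSpace 𝕜 E] : ‖shiftNull 𝕜 E‖ ≤ 1 :=
  LinearMap.mkContinuous_norm_le _ zero_le_one _

/-- Pointwise application of a linear map to null sequences. -/
def mapNull (T : E →L[ℝ] F) : C₀(ℕ, E) →L[ℝ] C₀(ℕ, F) :=
  LinearMap.mkContinuous
    { toFun := fun ζ => nullSeq (fun n => T (ζ n))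
        (by
          have := (T.continuous.tendsto 0).comp (tendsto_nullSeq ζ)
          rwa [map_zero] at this)
      map_add' := fun _ _ => by ext n; simp
      map_smul' := fun _ _ => by ext n; simp } ‖T‖ (fun ζ => by
        rw [norm_nullSeq_le (by positivity)]
        exact fun n => (T.le_opNorm _).trans (by gcongr; exact norm_apply_le ζ n))

@[simp] lemma mapNull_apply (T : E →L[ℝ] F) (ζ : C₀(ℕ, E)) (n : ℕ) :
    mapNull T ζ n = T (ζ n) := rfl

/-- The sequence `(bⁿ ζₙ)`, for `|b| ≤ 1`. -/
def weightNull (E : Type*) [NormedAddCommGroup E] [NormedSpace ℝ E] (b : ℝ) (hb : |b| ≤ 1) :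
    C₀(ℕ, E) →L[ℝ] (ℕ →ᵇ E) :=
  LinearMap.mkContinuous
    { toFun := fun ζ => BoundedContinuousFunction.ofNormedAddCommGroupDiscrete
        (fun n => b ^ n • ζ n) ‖ζ‖ (fun n => by
          rw [norm_smul, norm_pow]
          exact (mul_le_of_le_one_left (norm_nonneg _) (pow_le_one₀ (norm_nonneg _) hb)).trans
            (norm_apply_le ζ n))
      map_add' := fun _ _ => by ext n; simp
      map_smul' := fun c ζ => by ext n; exact smul_comm _ _ _ } 1 (fun ζ => by
        rw [one_mul]
        refine (BoundedContinuousFunction.norm_le (norm_nonneg _)).2 fun n => ?_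
        change ‖b ^ n • ζ n‖ ≤ ‖ζ‖
        rw [norm_smul, norm_pow]
        exact (mul_le_of_le_one_left (norm_nonneg _) (pow_le_one₀ (norm_nonneg _) hb)).trans
          (norm_apply_le ζ n))

@[simp] lemma weightNull_apply (b : ℝ) (hb : |b| ≤ 1) (ζ : C₀(ℕ, E)) (n : ℕ) :
    weightNull E b hb ζ n = b ^ n • ζ n := rfl

lemma norm_weightNull_le (b : ℝ) (hb : |b| ≤ 1) (ζ : C₀(ℕ, E)) : ‖weightNull E b hb ζ‖ ≤ ‖ζ‖ := by
  simpa using (weightNull E b hb).le_of_opNorm_le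
    (LinearMap.mkContinuous_norm_le _ zero_le_one _) ζ

set_option synthInstance.maxHeartbeats 200000 in
/-- A bounded sequence of linear maps acts on bounded sequences. -/
def mulBounded (E F : Type*) [NormedAddCommGroup E] [NormedSpace ℝ E]
    [NormedAddCommGroup F] [NormedSpace ℝ F] :
    (ℕ →ᵇ (E →L[ℝ] F)) →L[ℝ] (ℕ →ᵇ E) →L[ℝ] (ℕ →ᵇ F) :=
  LinearMap.mkContinuous₂
    (LinearMap.mk₂ ℝ (fun (A : ℕ →ᵇ (E →L[ℝ] F)) (ζ : ℕ →ᵇ E) => BoundedContinuousFunction.ofNormedAddCommGroupDiscrete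
        (fun n => A n (ζ n)) (‖A‖ * ‖ζ‖) (fun n => ((A n).le_opNorm _).trans (by
          gcongr
          · exact A.norm_coe_le_norm n
          · exact ζ.norm_coe_le_norm n)))
      (fun _ _ _ => by ext n; simp) (fun _ _ _ => by ext n; simp)
      (fun _ _ _ => by ext n; simp) (fun _ _ _ => by ext n; simp)) 1 (fun A ζ => by
        rw [one_mul]
        refine (BoundedContinuousFunction.norm_le (by positivity)).2 fun n => ?_
        refine ((A n).le_opNorm _).trans ?_
        gcongr
        · exact A.norm_coe_le_norm n
        · exact ζ.norm_coe_le_norm n)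

@[simp] lemma mulBounded_apply (A : ℕ →ᵇ (E →L[ℝ] F)) (ζ : ℕ →ᵇ E) (n : ℕ) :
    mulBounded E F A ζ n = A n (ζ n) := rfl

set_option synthInstance.maxHeartbeats 200000 in
/-- A bounded sequence of linear maps acts on null sequences. -/
def mulNull (E F : Type*) [NormedAddCommGroup E] [NormedSpace ℝ E]
    [NormedAddCommGroup F] [NormedSpace ℝ F] :
    (ℕ →ᵇ (E →L[ℝ] F)) →L[ℝ] C₀(ℕ, E) →L[ℝ] C₀(ℕ, F) :=
  LinearMap.mkContinuous₂
    (LinearMap.mk₂ ℝ (fun (A : ℕ →ᵇ (E →L[ℝ] F)) (ζ : C₀(ℕ, E)) => nullSeq (fun n => A n (ζ n)) (by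
        refine squeeze_zero_norm (a := fun n => ‖A‖ * ‖ζ n‖) (fun n => ?_) ?_
        · exact ((A n).le_opNorm _).trans (by gcongr; exact A.norm_coe_le_norm n)
        · simpa using (tendsto_nullSeq ζ).norm.const_mul ‖A‖))
      (fun _ _ _ => by ext n; simp) (fun _ _ _ => by ext n; simp)
      (fun _ _ _ => by ext n; simp) (fun _ _ _ => by ext n; simp)) 1 (fun A ζ => by
        rw [one_mul, norm_nullSeq_le (by positivity)]
        intro n
        refine ((A n).le_opNorm _).trans ?_
        gcongr
        · exact A.norm_coe_le_norm n
        · exact norm_apply_le ζ n)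

@[simp] lemma mulNull_apply (A : ℕ →ᵇ (E →L[ℝ] F)) (ζ : C₀(ℕ, E)) (n : ℕ) :
    mulNull E F A ζ n = A n (ζ n) := rfl

end Sequences

/-! ### Differentiability of superposition operators on bounded sequences. -/

section Superposition

set_option synthInstance.maxHeartbeats 200000

variable {E F : Type*} [NormedAddCommGroup E] [NormedSpace ℝ E] [FiniteDimensional ℝ E]
  [NormedAddCommGroup F] [NormedSpace ℝ F]

/-- A `C¹` map is uniformly differentiable on compact balls. -/
lemma uniform_differentiability {h : E → F} {U : Set E} (hU : IsOpen U)
    (hh : ContDiffOn ℝ 1 h U) {ρ : ℝ} (hρ : closedBall 0 ρ ⊆ U) {ε : ℝ} (hε : 0 < ε) :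
    ∃ δ > 0, ∀ v ∈ closedBall (0 : E) ρ, ∀ w ∈ closedBall (0 : E) ρ, ‖w - v‖ < δ →
      ‖h w - h v - fderiv ℝ h v (w - v)‖ ≤ ε * ‖w - v‖ := by
  have hc : ContinuousOn (fderiv ℝ h) (closedBall 0 ρ) :=
    (hh.continuousOn_fderiv_of_isOpen hU le_rfl).mono hρ
  have huc := (isCompact_closedBall (0 : E) ρ).uniformContinuousOn_of_continuous hc
  obtain ⟨δ, hδ, hd⟩ := Metric.uniformContinuousOn_iff.1 huc ε hε
  refine ⟨δ, hδ, fun v hv w hw hvw => ?_⟩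
  have hconv : Convex ℝ (closedBall (0 : E) ρ ∩ ball v δ) :=
    (convex_closedBall _ _).inter (convex_ball _ _)
  refine hconv.norm_image_sub_le_of_norm_hasFDerivWithin_le' (f := h) (f' := fderiv ℝ h)
    (φ := fderiv ℝ h v) ?_ ?_ ⟨hv, mem_ball_self hδ⟩ ⟨hw, by rwa [mem_ball, dist_eq_norm]⟩
  · intro z hz
    exact ((hh.differentiableOn one_ne_zero).differentiableAt
      (hU.mem_nhds (hρ hz.1))).hasFDerivAt.hasFDerivWithinAt
  · intro z hz
    rw [← dist_eq_norm]
    exact (hd z hz.1 v hv (mem_ball.1 hz.2)).le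

/-- The superposition operator `ζ ↦ (h (ζ n))` on bounded sequences (zero where undefined). -/
def superposition (h : E → F) (ζ : ℕ →ᵇ E) : ℕ →ᵇ F :=
  open Classical in
  if H : ∃ C, ∀ n, ‖h (ζ n)‖ ≤ C then
    BoundedContinuousFunction.ofNormedAddCommGroupDiscrete (fun n => h (ζ n)) H.choose H.choose_spec
  else 0

omit [NormedSpace ℝ F] in
lemma superposition_apply {h : E → F} {ρ : ℝ} (hh : ContinuousOn h (closedBall 0 ρ)) {ζ : ℕ →ᵇ E}
    (hζ : ‖ζ‖ ≤ ρ) (n : ℕ) : superposition h ζ n = h (ζ n) := by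
  have H : ∃ C, ∀ n, ‖h (ζ n)‖ ≤ C := by
    obtain ⟨C, hC⟩ := (isCompact_closedBall (0 : E) ρ).exists_bound_of_continuousOn hh
    exact ⟨C, fun n => hC _ (by simpa using (ζ.norm_coe_le_norm n).trans hζ)⟩
  rw [superposition, dif_pos H]
  rfl

/-- Closed balls of `E` are compact, so the first-order remainder of `h` is controlled with one `δ`
at all points of the ball. The termwise estimates are then uniform in `n`, which is an estimate in
the supremum norm. -/
lemma hasFDerivAt_superposition {h : E → F} {U : Set E} (hU : IsOpen U)
    (hh : ContDiffOn ℝ 1 h U) {ρ : ℝ} (hρ : closedBall 0 ρ ⊆ U) {ζ : ℕ →ᵇ E} (hζ : ‖ζ‖ < ρ) :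
    HasFDerivAt (superposition h) (mulBounded E F (superposition (fderiv ℝ h) ζ)) ζ := by
  have hc0 : ContinuousOn h (closedBall 0 ρ) := hh.continuousOn.mono hρ
  have hc : ContinuousOn (fderiv ℝ h) (closedBall 0 ρ) :=
    (hh.continuousOn_fderiv_of_isOpen hU le_rfl).mono hρ
  rw [hasFDerivAt_iff_isLittleO, Asymptotics.isLittleO_iff]
  intro ε hε
  obtain ⟨δ, hδ, hd⟩ := uniform_differentiability hU hh hρ hε
  have h1 : ∀ᶠ ξ in 𝓝 ζ, ‖ξ‖ < ρ := (continuous_norm.tendsto ζ).eventually (gt_mem_nhds hζ)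
  filter_upwards [h1, ball_mem_nhds ζ hδ] with ξ hξ hξ'
  rw [BoundedContinuousFunction.norm_le (by positivity)]
  intro n
  have hn : ‖ξ n - ζ n‖ ≤ ‖ξ - ζ‖ := (ξ - ζ).norm_coe_le_norm n
  rw [mem_ball, dist_eq_norm] at hξ'
  simp only [BoundedContinuousFunction.coe_sub, Pi.sub_apply, mulBounded_apply,
    superposition_apply hc0 hξ.le, superposition_apply hc0 hζ.le, superposition_apply hc hζ.le]
  refine (hd _ ?_ _ ?_ (hn.trans_lt hξ')).trans (by gcongr)
  · simpa using (ζ.norm_coe_le_norm n).trans hζ.le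
  · simpa using (ξ.norm_coe_le_norm n).trans hξ.le

end Superposition

/-! ### Higher regularity, and the rescaled operator on null sequences. -/

section SuperpositionSmooth

set_option synthInstance.maxHeartbeats 200000

universe v
variable {E : Type v} [NormedAddCommGroup E] [NormedSpace ℝ E] [FiniteDimensional ℝ E]

/-- The derivative is the superposition operator of `fderiv ℝ h` followed by a continuous linear
map. The induction thus passes from the target `F` to `E →L[ℝ] F`, which is why `F` is quantified
inside it. -/
lemma contDiffOn_superposition_nat {U : Set E} (hU : IsOpen U) {ρ : ℝ} (hρ : closedBall 0 ρ ⊆ U)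
    (k : ℕ) : ∀ {F : Type v} [NormedAddCommGroup F] [NormedSpace ℝ F] {h : E → F},
      ContDiffOn ℝ k h U → ContDiffOn ℝ k (superposition h) (ball 0 ρ) := by
  induction k with
  | zero =>
    intro F _ _ h hh
    rw [Nat.cast_zero, contDiffOn_zero] at hh ⊢
    have hc0 : ContinuousOn h (closedBall 0 ρ) := hh.mono hρ
    have huc := (isCompact_closedBall (0 : E) ρ).uniformContinuousOn_of_continuous hc0
    rw [Metric.continuousOn_iff]
    intro ζ hζ ε hε
    obtain ⟨δ, hδ, hd⟩ := Metric.uniformContinuousOn_iff.1 huc (ε / 2) (by positivity)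
    refine ⟨δ, hδ, fun ξ hξ hξζ => ?_⟩
    rw [mem_ball_zero_iff] at hζ hξ
    refine lt_of_le_of_lt ((BoundedContinuousFunction.dist_le (by positivity)).2 fun n => ?_)
      (half_lt_self hε)
    rw [superposition_apply hc0 hξ.le, superposition_apply hc0 hζ.le]
    refine (hd _ ?_ _ ?_ ((BoundedContinuousFunction.dist_coe_le_dist n).trans_lt hξζ)).le
    · simpa using (ξ.norm_coe_le_norm n).trans hξ.le
    · simpa using (ζ.norm_coe_le_norm n).trans hζ.le
  | succ k ih =>
    intro F _ _ h hh
    have hh1 : ContDiffOn ℝ 1 h U := hh.of_le (by exact_mod_cast Nat.le_add_left 1 k)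
    have hD : ∀ ζ ∈ ball (0 : ℕ →ᵇ E) ρ, HasFDerivAt (superposition h)
        (mulBounded E F (superposition (fderiv ℝ h) ζ)) ζ := fun ζ hζ =>
      hasFDerivAt_superposition hU hh1 hρ (mem_ball_zero_iff.1 hζ)
    have hk : ContDiffOn ℝ k (fderiv ℝ h) U := hh.fderiv_of_isOpen hU (by simp)
    rw [Nat.cast_succ, contDiffOn_succ_iff_fderiv_of_isOpen isOpen_ball]
    refine ⟨fun ζ hζ => (hD ζ hζ).differentiableAt.differentiableWithinAt, by simp, ?_⟩
    have hc : ContDiffOn ℝ k (fun ζ => mulBounded E F (superposition (fderiv ℝ h) ζ))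
        (ball 0 ρ) :=
      ContDiff.comp_contDiffOn (g := fun A => mulBounded E F A) (by fun_prop) (ih hk)
    exact hc.congr fun ζ hζ => (hD ζ hζ).fderiv

/-- The rescaled superposition operator `ζ ↦ (b⁻ⁿ⁻¹ g (bⁿ ζₙ))` on null sequences
(zero where undefined). -/
def rescaled (b : ℝ) (g : E → E) (ζ : C₀(ℕ, E)) : C₀(ℕ, E) :=
  open Classical in
  if H : Tendsto (fun n => (b ^ (n + 1))⁻¹ • g (b ^ n • ζ n)) atTop (𝓝 0) then
    nullSeq _ H
  else 0

variable {b : ℝ} {g : E → E} {U : Set E} {ρ : ℝ}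

omit [FiniteDimensional ℝ E] in
lemma weight_smul_mem (hb0 : 0 < b) (hb1 : b ≤ 1) {ζ : C₀(ℕ, E)} (hζ : ‖ζ‖ ≤ ρ) (n : ℕ) :
    b ^ n • ζ n ∈ closedBall (0 : E) ρ := by
  rw [mem_closedBall_zero_iff, norm_smul, norm_pow, Real.norm_of_nonneg hb0.le]
  exact (mul_le_of_le_one_left (norm_nonneg _) (pow_le_one₀ hb0.le hb1)).trans
    ((norm_apply_le ζ n).trans hζ)

/-- Since `g 0 = 0` and `g` is Lipschitz on the ball with some constant `C`, the `n`-th term is at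
most `b⁻¹ C ‖ζ n‖`: the growing weight is absorbed and the sequence is null. -/
lemma rescaled_apply (hb0 : 0 < b) (hb1 : b ≤ 1) (hU : IsOpen U) (hg : ContDiffOn ℝ 1 g U)
    (hg0 : g 0 = 0) (hρ : closedBall 0 ρ ⊆ U) {ζ : C₀(ℕ, E)} (hζ : ‖ζ‖ ≤ ρ) (n : ℕ) :
    rescaled b g ζ n = (b ^ (n + 1))⁻¹ • g (b ^ n • ζ n) := by
  have H : Tendsto (fun n => (b ^ (n + 1))⁻¹ • g (b ^ n • ζ n)) atTop (𝓝 0) := by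
    obtain ⟨C, hC⟩ := (isCompact_closedBall (0 : E) ρ).exists_bound_of_continuousOn
      ((hg.continuousOn_fderiv_of_isOpen hU le_rfl).mono hρ)
    have hρ0 : 0 ≤ ρ := (norm_nonneg _).trans hζ
    have key : ∀ v ∈ closedBall (0 : E) ρ, ‖g v‖ ≤ C * ‖v‖ := fun v hv => by
      simpa [hg0] using (convex_closedBall (0 : E) ρ).norm_image_sub_le_of_norm_fderiv_le (f := g)
        (fun z hz => (hg.differentiableOn one_ne_zero).differentiableAt (hU.mem_nhds (hρ hz))) hC
        (mem_closedBall_self hρ0) hv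
    refine squeeze_zero_norm (a := fun n => b⁻¹ * C * ‖ζ n‖) (fun n => ?_) ?_
    · rw [norm_smul, norm_inv, norm_pow, Real.norm_of_nonneg hb0.le]
      refine (mul_le_mul_of_nonneg_left (key _ (weight_smul_mem hb0 hb1 hζ n))
        (by positivity)).trans (le_of_eq ?_)
      rw [norm_smul, norm_pow, Real.norm_of_nonneg hb0.le]
      rw [pow_succ]
      field_simp
    · simpa using (tendsto_nullSeq ζ).norm.const_mul (b⁻¹ * C)
  rw [rescaled, dif_pos H, nullSeq_apply]

/-- The derivative of the rescaled superposition operator. -/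
def rescaledDeriv (b : ℝ) (hb : |b| ≤ 1) (g : E → E) (ζ : C₀(ℕ, E)) : C₀(ℕ, E) →L[ℝ] C₀(ℕ, E) :=
  b⁻¹ • mulNull E E (superposition (fderiv ℝ g) (weightNull E b hb ζ))

lemma rescaledDeriv_apply (hb : |b| ≤ 1) (hU : IsOpen U)
    (hg : ContDiffOn ℝ 1 g U) (hρ : closedBall 0 ρ ⊆ U) {ζ : C₀(ℕ, E)} (hζ : ‖ζ‖ ≤ ρ)
    (ξ : C₀(ℕ, E)) (n : ℕ) :
    rescaledDeriv b hb g ζ ξ n = b⁻¹ • fderiv ℝ g (b ^ n • ζ n) (ξ n) := by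
  have hc := (hg.continuousOn_fderiv_of_isOpen hU le_rfl).mono hρ
  simp only [rescaledDeriv, smul_apply, ZeroAtInftyContinuousMap.smul_apply,
    mulNull_apply]
  rw [superposition_apply hc ((norm_weightNull_le b hb ζ).trans hζ), weightNull_apply]

lemma hasFDerivAt_rescaled (hb0 : 0 < b) (hb1 : b ≤ 1) (hb : |b| ≤ 1) (hU : IsOpen U)
    (hg : ContDiffOn ℝ 1 g U) (hg0 : g 0 = 0) (hρ : closedBall 0 ρ ⊆ U)
    {ζ : C₀(ℕ, E)} (hζ : ‖ζ‖ < ρ) :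
    HasFDerivAt (rescaled b g) (rescaledDeriv b hb g ζ) ζ := by
  rw [hasFDerivAt_iff_isLittleO, Asymptotics.isLittleO_iff]
  intro ε hε
  -- The tolerance `b * ε` pays for the one uncompensated factor: the weight outside is `(b ^ (n +
  -- 1))⁻¹`, while the increment inside carries only `b ^ n`.
  obtain ⟨δ, hδ, hd⟩ := uniform_differentiability hU hg hρ (ε := b * ε) (by positivity)
  have h1 : ∀ᶠ ξ in 𝓝 ζ, ‖ξ‖ < ρ := (continuous_norm.tendsto ζ).eventually (gt_mem_nhds hζ)
  filter_upwards [h1, ball_mem_nhds ζ hδ] with ξ hξ hξ'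
  rw [norm_nullSeq_le (by positivity)]
  intro n
  have hn : ‖ξ n - ζ n‖ ≤ ‖ξ - ζ‖ := norm_apply_le (ξ - ζ) n
  rw [mem_ball, dist_eq_norm] at hξ'
  simp only [ZeroAtInftyContinuousMap.sub_apply, rescaled_apply hb0 hb1 hU hg hg0 hρ hξ.le,
    rescaled_apply hb0 hb1 hU hg hg0 hρ hζ.le, rescaledDeriv_apply hb hU hg hρ hζ.le]
  have hbn : ‖b ^ n • ξ n - b ^ n • ζ n‖ = b ^ n * ‖ξ n - ζ n‖ := by
    rw [← smul_sub, norm_smul, norm_pow, Real.norm_of_nonneg hb0.le]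
  have hb1n : b ^ n ≤ 1 := pow_le_one₀ hb0.le hb1
  have key := hd _ (weight_smul_mem hb0 hb1 hζ.le n) _ (weight_smul_mem hb0 hb1 hξ.le n) (by
    rw [hbn]
    exact (mul_le_of_le_one_left (norm_nonneg _) hb1n).trans_lt (hn.trans_lt hξ'))
  have heq : (b ^ (n + 1))⁻¹ • g (b ^ n • ξ n) - (b ^ (n + 1))⁻¹ • g (b ^ n • ζ n)
      - b⁻¹ • fderiv ℝ g (b ^ n • ζ n) (ξ n - ζ n)
      = (b ^ (n + 1))⁻¹ • (g (b ^ n • ξ n) - g (b ^ n • ζ n)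
        - fderiv ℝ g (b ^ n • ζ n) (b ^ n • ξ n - b ^ n • ζ n)) := by
    rw [← smul_sub (b ^ n), map_smul, smul_sub, smul_sub, smul_smul]
    congr 2
    rw [pow_succ]
    field_simp
  rw [heq, norm_smul, norm_inv, norm_pow, Real.norm_of_nonneg hb0.le]
  calc (b ^ (n + 1))⁻¹ * _ ≤ (b ^ (n + 1))⁻¹ * (b * ε * (b ^ n * ‖ξ n - ζ n‖)) := by
        rw [hbn] at key
        gcongr
    _ = ε * ‖ξ n - ζ n‖ := by rw [pow_succ]; field_simp
    _ ≤ _ := by gcongr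

/-- The weights `b^{-n-1}` are unbounded when `b < 1`, so the operator is not simply a bounded
linear map after a superposition. Its derivative is: there the weights cancel up to the factor
`b⁻¹`. The first derivative is therefore computed by hand, and the remaining regularity comes from
the superposition operator of `fderiv ℝ g`. -/
lemma contDiffOn_rescaled (hb0 : 0 < b) (hb1 : b ≤ 1) (hU : IsOpen U) {r : ℕ∞} (hr : 1 ≤ r)
    (hg : ContDiffOn ℝ r g U) (hg0 : g 0 = 0) (hρ : closedBall 0 ρ ⊆ U) :
    ContDiffOn ℝ r (rescaled b g) (ball 0 ρ) := by
  have hb : |b| ≤ 1 := by rwa [abs_of_pos hb0]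
  have hg1 : ContDiffOn ℝ 1 g U := hg.of_le (by exact_mod_cast hr)
  have main : ∀ k : ℕ, ((k + 1 : ℕ) : ℕ∞) ≤ r →
      ContDiffOn ℝ ((k + 1 : ℕ) : ℕ∞) (rescaled b g) (ball 0 ρ) := by
    intro k hk
    have hgk : ContDiffOn ℝ (k + 1) g U := hg.of_le (by exact_mod_cast hk)
    have hD : ∀ ζ ∈ ball (0 : C₀(ℕ, E)) ρ, HasFDerivAt (rescaled b g) (rescaledDeriv b hb g ζ) ζ :=
      fun ζ hζ => hasFDerivAt_rescaled hb0 hb1 hb hU hg1 hg0 hρ (mem_ball_zero_iff.1 hζ)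
    have hk' : ContDiffOn ℝ k (fderiv ℝ g) U := hgk.fderiv_of_isOpen hU le_rfl
    have : ((((k + 1 : ℕ) : ℕ∞)) : ℕ∞ω) = (k : ℕ∞ω) + 1 := by push_cast; rfl
    rw [this, contDiffOn_succ_iff_fderiv_of_isOpen isOpen_ball]
    refine ⟨fun ζ hζ => (hD ζ hζ).differentiableAt.differentiableWithinAt, by simp, ?_⟩
    have hs := (contDiffOn_superposition_nat hU hρ k hk').comp
      (weightNull E b hb).contDiff.contDiffOn (s := ball 0 ρ) (fun ζ hζ => by
        rw [mem_ball_zero_iff] at hζ ⊢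
        exact (norm_weightNull_le b hb ζ).trans_lt hζ)
    have hc : ContDiffOn ℝ k (fun ζ => mulNull E E (superposition (fderiv ℝ g)
        (weightNull E b hb ζ))) (ball 0 ρ) :=
      ContDiff.comp_contDiffOn (g := fun A => mulNull E E A) (by fun_prop) hs
    exact (hc.const_smul b⁻¹).congr fun ζ hζ => (hD ζ hζ).fderiv
  rw [contDiffOn_iff_forall_nat_le]
  intro k hk
  rcases k with _ | k
  · exact (main 0 (by simpa using hr)).of_le (by simp)
  · exact main k (by exact_mod_cast hk)

end SuperpositionSmooth

end ConformallySymplectic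

end

noncomputable section

namespace ConformallySymplectic

open scoped BoundedContinuousFunction ZeroAtInfty
open Filter Set Metric

/-! ### Linear theory: solving `ζ_{n+1} = T ζ_n + w_n` in null sequences. -/

section ShiftSpectrum

open Polynomial

section Banach

variable {X : Type*} [NormedAddCommGroup X] [NormedSpace ℂ X] [CompleteSpace X]
  {S R : X →L[ℂ] X}

/-- For `‖z‖ > 1` the number `z` is outside the spectrum of the contraction `S`. For `‖z‖ < 1` write
`S - z = S (1 - z R)`, where `S` is onto and the second factor is invertible by a Neumann series. -/
lemma surjective_sub_smul_one (hS1 : ‖S‖ ≤ 1) (hR1 : ‖R‖ ≤ 1) (hSR : S * R = 1)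
    {z : ℂ} (hz : ‖z‖ ≠ 1) :
    Function.Surjective (S - z • (1 : X →L[ℂ] X)) := by
  have key : ∀ A : X →L[ℂ] X, IsUnit A → Function.Surjective A := by
    rintro _ ⟨u, rfl⟩ w
    exact ⟨(↑u⁻¹ : X →L[ℂ] X) w, by
      rw [← mul_apply_eq_comp, u.mul_inv, one_apply_eq_self]⟩
  rcases lt_or_gt_of_ne hz with h | h
  · have hR : ‖z • R‖ < 1 := by
      rw [norm_smul]
      exact (mul_le_of_le_one_right (norm_nonneg _) hR1).trans_lt h
    have hS : Function.Surjective S := fun w => ⟨R w, by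
      rw [← mul_apply_eq_comp, hSR]; rfl⟩
    have hfac : S - z • (1 : X →L[ℂ] X) = S * (1 - z • R) := by
      rw [mul_sub, mul_one, mul_smul_comm, hSR]
    rw [hfac]
    exact hS.comp (key _ (isUnit_one_sub_of_norm_lt_one hR))
  · refine key _ ?_
    have h1 : ‖S‖ * ‖(1 : X →L[ℂ] X)‖ < ‖z‖ := by
      refine lt_of_le_of_lt ?_ h
      exact mul_le_one₀ hS1 (norm_nonneg _) ContinuousLinearMap.norm_id_le
    have := spectrum.mem_resolventSet_of_norm_lt_mul h1
    rw [spectrum.mem_resolventSet_iff] at this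
    simpa [Algebra.algebraMap_eq_smul_one] using this.neg

lemma surjective_aeval_of_rightInverse (hS1 : ‖S‖ ≤ 1) (hR1 : ‖R‖ ≤ 1) (hSR : S * R = 1)
    {p : ℂ[X]} (hp : p ≠ 0) (hroot : ∀ z, p.IsRoot z → ‖z‖ ≠ 1) :
    Function.Surjective (aeval S p) := by
  have main : ∀ s : Multiset ℂ, (∀ z ∈ s, ‖z‖ ≠ 1) →
      Function.Surjective (aeval S (s.map fun z => Polynomial.X - C z).prod) := by
    intro s
    induction s using Multiset.induction with
    | empty => intro _ w; exact ⟨w, by simp⟩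
    | cons z s ih =>
      intro h
      rw [Multiset.map_cons, Multiset.prod_cons, map_mul, map_sub, aeval_X, aeval_C,
        Algebra.algebraMap_eq_smul_one]
      exact (surjective_sub_smul_one hS1 hR1 hSR (h z (Multiset.mem_cons_self _ _))).comp
        (ih fun y hy => h y (Multiset.mem_cons_of_mem hy))
  rw [(IsAlgClosed.splits p).eq_prod_roots, map_mul, aeval_C, Algebra.algebraMap_eq_smul_one,
    smul_mul_assoc, one_mul]
  intro w
  obtain ⟨v, hv⟩ := main p.roots (fun z hz => hroot z (isRoot_of_mem_roots hz))
    (p.leadingCoeff⁻¹ • w)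
  exact ⟨v, by rw [smul_apply, hv, smul_inv_smul₀ (leadingCoeff_ne_zero.2 hp)]⟩

end Banach

/-- The right shift of null sequences. -/
def rightShiftNull (V : Type*) [NormedAddCommGroup V] [NormedSpace ℂ V] : C₀(ℕ, V) →L[ℂ] C₀(ℕ, V) :=
  LinearMap.mkContinuous
    { toFun := fun ζ => nullSeq (fun n => Nat.casesOn n 0 fun k => ζ k)
        ((tendsto_add_atTop_iff_nat 1).1 (tendsto_nullSeq ζ))
      map_add' := fun _ _ => by ext n; cases n <;> simp
      map_smul' := fun _ _ => by ext n; cases n <;> simp } 1 (fun ζ => by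
        rw [one_mul, norm_nullSeq_le (norm_nonneg _)]
        intro n
        cases n with
        | zero => simp
        | succ n => exact norm_apply_le ζ n)

variable {V : Type*} [NormedAddCommGroup V] [NormedSpace ℂ V]

lemma shiftNull_comp_rightShiftNull : shiftNull ℂ V * rightShiftNull V = 1 := by
  ext ζ n
  rfl

lemma shiftNull_pow_apply {𝕜 E : Type*} [NontriviallyNormedField 𝕜] [NormedAddCommGroup E]
    [NormedSpace 𝕜 E] (i : ℕ) (ζ : C₀(ℕ, E)) (n : ℕ) :
    (shiftNull 𝕜 E ^ i) ζ n = ζ (n + i) := by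
  induction i generalizing n with
  | zero => rfl
  | succ i ih => rw [pow_succ', mul_apply_eq_comp, shiftNull_apply, ih]; congr 1; ring

lemma finsetSum_nullSeq_apply {E ι : Type*} [NormedAddCommGroup E] (s : Finset ι)
    (f : ι → C₀(ℕ, E)) (n : ℕ) : (∑ i ∈ s, f i) n = ∑ i ∈ s, f i n := by
  classical
  induction s using Finset.induction with
  | empty => simp
  | insert i s hi ih => rw [Finset.sum_insert hi, Finset.sum_insert hi, ← ih]; rfl

lemma aeval_shiftNull_apply {𝕜 E : Type*} [NontriviallyNormedField 𝕜] [NormedAddCommGroup E]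
    [NormedSpace 𝕜 E] (p : 𝕜[X]) (ζ : C₀(ℕ, E)) (n : ℕ) :
    aeval (shiftNull 𝕜 E) p ζ n = ∑ i ∈ Finset.range (p.natDegree + 1), p.coeff i • ζ (n + i) := by
  rw [aeval_eq_sum_range, sum_apply, finsetSum_nullSeq_apply]
  refine Finset.sum_congr rfl fun i _ => ?_
  rw [smul_apply, ZeroAtInftyContinuousMap.smul_apply, shiftNull_pow_apply]

/-- The equation is solved over `ℂ`, where `p` splits into linear factors. As `p` has real
coefficients and the right-hand side is real, the real part of a solution is again a solution. -/
lemma surjective_aeval_shiftNull_real {p : ℝ[X]} (hp : p ≠ 0)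
    (hroot : ∀ z, (p.map (algebraMap ℝ ℂ)).IsRoot z → ‖z‖ ≠ 1) :
    Function.Surjective (aeval (shiftNull ℝ ℝ) p) := by
  intro w
  have hw : Tendsto (fun n => (w n : ℂ)) atTop (𝓝 0) := by
    have := (Complex.continuous_ofReal.tendsto 0).comp (tendsto_nullSeq w)
    rwa [Complex.ofReal_zero] at this
  obtain ⟨v, hv⟩ := surjective_aeval_of_rightInverse
    (norm_shiftNull_le (𝕜 := ℂ) (E := ℂ))
    (LinearMap.mkContinuous_norm_le _ zero_le_one _ : ‖rightShiftNull ℂ‖ ≤ 1)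
    shiftNull_comp_rightShiftNull (p := p.map (algebraMap ℝ ℂ))
    ((Polynomial.map_ne_zero_iff (algebraMap ℝ ℂ).injective).2 hp) hroot (nullSeq _ hw)
  have hvr : Tendsto (fun n => (v n).re) atTop (𝓝 0) := by
    have := (Complex.continuous_re.tendsto 0).comp (tendsto_nullSeq v)
    rwa [Complex.zero_re] at this
  refine ⟨nullSeq _ hvr, ?_⟩
  ext n
  have := congrArg Complex.re (DFunLike.congr_fun hv n)
  rw [aeval_shiftNull_apply, nullSeq_apply, natDegree_map] at this
  rw [aeval_shiftNull_apply, ← Complex.ofReal_re (w n), ← this, Complex.re_sum]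
  refine Finset.sum_congr rfl fun i _ => ?_
  simp

variable {E : Type*} [NormedAddCommGroup E] [NormedSpace ℝ E] [FiniteDimensional ℝ E]

lemma surjective_aeval_shiftNull_finiteDimensional {p : ℝ[X]} (hp : p ≠ 0)
    (hroot : ∀ z, (p.map (algebraMap ℝ ℂ)).IsRoot z → ‖z‖ ≠ 1) :
    Function.Surjective (aeval (shiftNull ℝ E) p) := by
  intro w
  let B := Module.finBasis ℝ E
  choose v hv using fun j => surjective_aeval_shiftNull_real hp hroot
    (mapNull (LinearMap.toContinuousLinearMap (B.coord j)) w)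
  refine ⟨∑ j, mapNull ((ContinuousLinearMap.id ℝ ℝ).smulRight (B j)) (v j), ?_⟩
  ext n
  rw [aeval_shiftNull_apply]
  have h1 : ∀ j, ∑ i ∈ Finset.range (p.natDegree + 1), p.coeff i • v j (n + i)
      = B.coord j (w n) := fun j => by
    rw [← aeval_shiftNull_apply, hv]; rfl
  rw [← B.sum_repr (w n)]
  simp only [finsetSum_nullSeq_apply, Finset.smul_sum]
  rw [Finset.sum_comm]
  refine Finset.sum_congr rfl fun j _ => ?_
  have := h1 j
  rw [Module.Basis.coord_apply] at this
  rw [← this, Finset.sum_smul]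
  refine Finset.sum_congr rfl fun i _ => ?_
  simp [smul_smul]

-- With `x` the shift, `y` the termwise action of `T` and `p` the characteristic polynomial of `T`,
-- Cayley–Hamilton kills `aeval y p`. Then `p(S) = (S - T) Q`, and surjectivity of `p(S)` gives that
-- of `S - T`.
omit [FiniteDimensional ℝ E] in
lemma exists_aeval_sub_aeval_eq {A : Type*} [Ring A] [Algebra ℝ A] {x y : A} (h : Commute x y)
    (p : ℝ[X]) : ∃ q : A, aeval x p - aeval y p = (x - y) * q := by
  induction p using Polynomial.induction_on' with
  | add p q hp hq =>
    obtain ⟨a, ha⟩ := hp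
    obtain ⟨b, hb⟩ := hq
    exact ⟨a + b, by rw [mul_add, ← ha, ← hb, map_add, map_add]; abel⟩
  | monomial n c =>
    refine ⟨c • ∑ i ∈ Finset.range n, x ^ i * y ^ (n - 1 - i), ?_⟩
    rw [mul_smul_comm, h.mul_geom_sum₂, aeval_monomial, aeval_monomial, smul_sub,
      Algebra.algebraMap_eq_smul_one, smul_mul_assoc, smul_mul_assoc, one_mul, one_mul]

/-- If no complex eigenvalue of `T` has modulus one, then the equation `ζₙ₊₁ = T ζₙ + wₙ` is solvable
in null sequences. -/
lemma surjective_shiftNull_sub_mapNull (T : E →L[ℝ] E)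
    (hT : ∀ z, ((T : E →ₗ[ℝ] E).charpoly.map (algebraMap ℝ ℂ)).IsRoot z → ‖z‖ ≠ 1) :
    Function.Surjective (shiftNull ℝ E - mapNull T) := by
  set p := (T : E →ₗ[ℝ] E).charpoly with hp
  have hcomm : Commute (shiftNull ℝ E) (mapNull T) := by
    ext ζ n
    rfl
  obtain ⟨Q, hQ⟩ := exists_aeval_sub_aeval_eq hcomm p
  have hpow : ∀ (i : ℕ) (ζ : C₀(ℕ, E)) (n : ℕ),
      (mapNull T ^ i) ζ n = ((T : E →ₗ[ℝ] E) ^ i) (ζ n) := by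
    intro i
    induction i with
    | zero => intro ζ n; rfl
    | succ i ih =>
      intro ζ n
      rw [pow_succ', mul_apply_eq_comp, mapNull_apply, ih, pow_succ']
      rfl
  have h0 : aeval (mapNull T) p = 0 := by
    ext ζ n
    have hch := LinearMap.congr_fun (LinearMap.aeval_self_charpoly (T : E →ₗ[ℝ] E)) (ζ n)
    rw [← hp, aeval_eq_sum_range, LinearMap.sum_apply] at hch
    rw [aeval_eq_sum_range, sum_apply, finsetSum_nullSeq_apply]
    refine Eq.trans (Finset.sum_congr rfl fun i _ => ?_) hch
    rw [smul_apply, ZeroAtInftyContinuousMap.smul_apply, hpow]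
    rfl
  intro w
  obtain ⟨v, hv⟩ := surjective_aeval_shiftNull_finiteDimensional (E := E)
    (LinearMap.charpoly_monic (T : E →ₗ[ℝ] E)).ne_zero hT w
  refine ⟨Q v, ?_⟩
  rw [← mul_apply_eq_comp, ← hQ, h0, sub_zero]
  exact hv

end ShiftSpectrum

end ConformallySymplectic

end

noncomputable section

namespace ConformallySymplectic

open scoped BoundedContinuousFunction ZeroAtInfty
open Filter Set Metric

/-! ### The local stable manifold, as a solution set in sequence space. -/

section LocalStable

set_option synthInstance.maxHeartbeats 200000

universe v
variable {E : Type v} [NormedAddCommGroup E] [NormedSpace ℝ E] [FiniteDimensional ℝ E]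

/-- The sequence `(bⁿ ζₙ)` is an orbit of `g`. -/
def IsRescaledOrbit (b : ℝ) (g : E → E) (ζ : C₀(ℕ, E)) : Prop :=
  ∀ n, b ^ (n + 1) • ζ (n + 1) = g (b ^ n • ζ n)

variable {b : ℝ} {g : E → E} {U : Set E} {ρ : ℝ}

lemma isRescaledOrbit_iff (hb0 : 0 < b) (hb1 : b ≤ 1) (hU : IsOpen U) (hg : ContDiffOn ℝ 1 g U)
    (hg0 : g 0 = 0) (hρ : closedBall 0 ρ ⊆ U) {ζ : C₀(ℕ, E)} (hζ : ‖ζ‖ ≤ ρ) :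
    IsRescaledOrbit b g ζ ↔ shiftNull ℝ E ζ - rescaled b g ζ = 0 := by
  rw [sub_eq_zero]
  refine ⟨fun h => ?_, fun h n => ?_⟩
  · ext n
    rw [shiftNull_apply, rescaled_apply hb0 hb1 hU hg hg0 hρ hζ, ← h n,
      inv_smul_smul₀ (by positivity)]
  · have := DFunLike.congr_fun h n
    rw [shiftNull_apply, rescaled_apply hb0 hb1 hU hg hg0 hρ hζ] at this
    rw [this, smul_inv_smul₀ (by positivity)]

/-- The small null orbits of a rescaled map without eigenvalues of modulus `b` form a `C^r` graph
over a finite-dimensional space. -/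
theorem exists_chart_null_orbits (hb0 : 0 < b) (hb1 : b ≤ 1) (hU : IsOpen U) {r : ℕ∞} (hr : 1 ≤ r)
    (hg : ContDiffOn ℝ r g U) (hg0 : g 0 = 0) (hρ0 : 0 < ρ) (hρ : closedBall 0 ρ ⊆ U)
    (hT : ∀ z, (((b⁻¹ • fderiv ℝ g 0 : E →L[ℝ] E) : E →ₗ[ℝ] E).charpoly.map
      (algebraMap ℝ ℂ)).IsRoot z → ‖z‖ ≠ 1) :
    ∃ (k : ℕ) (V : Set (EuclideanSpace ℝ (Fin k))) (σ : EuclideanSpace ℝ (Fin k) → C₀(ℕ, E))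
      (P : C₀(ℕ, E) →L[ℝ] EuclideanSpace ℝ (Fin k)) (δ : ℝ), 0 < δ ∧ δ ≤ ρ ∧ IsOpen V ∧
      ContDiffOn ℝ r σ V ∧ (∀ v ∈ V, ‖σ v‖ < δ ∧ IsRescaledOrbit b g (σ v)) ∧
      (∀ ζ, ‖ζ‖ < δ → IsRescaledOrbit b g ζ → P ζ ∈ V ∧ σ (P ζ) = ζ) ∧
      ∀ v ∈ V, P (σ v) = v := by
  have hb : |b| ≤ 1 := by rwa [abs_of_pos hb0]
  have hg1 : ContDiffOn ℝ 1 g U := hg.of_le (by exact_mod_cast hr)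
  set T : E →L[ℝ] E := b⁻¹ • fderiv ℝ g 0 with hTdef
  set L : C₀(ℕ, E) →L[ℝ] C₀(ℕ, E) := shiftNull ℝ E - mapNull T with hL
  have hLsurj : Function.Surjective L := surjective_shiftNull_sub_mapNull T hT
  let K : Submodule ℝ C₀(ℕ, E) := LinearMap.ker (L : C₀(ℕ, E) →ₗ[ℝ] C₀(ℕ, E))
  have hKmem : ∀ ζ, ζ ∈ K ↔ L ζ = 0 := fun ζ => Iff.rfl
  have hKrec : ∀ ζ ∈ K, ∀ n, ζ (n + 1) = T (ζ n) := fun ζ hζ n => by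
    have := DFunLike.congr_fun ((hKmem ζ).1 hζ) n
    rw [hL] at this
    simpa [sub_eq_zero] using this
  -- A sequence in the kernel satisfies `ζ_{n+1} = T ζ_n`, so its initial entry determines it.
  have hKfin : FiniteDimensional ℝ K := by
    refine FiniteDimensional.of_injective
      ((evalNull E 0 : C₀(ℕ, E) →ₗ[ℝ] E).comp K.subtype) ?_
    rw [← LinearMap.ker_eq_bot, LinearMap.ker_eq_bot']
    rintro ⟨ζ, hζ⟩ h0
    have h0' : ζ 0 = 0 := h0
    have : ∀ n, ζ n = 0 := fun n => by
      induction n with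
      | zero => exact h0'
      | succ n ih => rw [hKrec ζ hζ n, ih, map_zero]
    ext n
    exact this n
  obtain ⟨pr, hpr⟩ := Submodule.ClosedComplemented.of_finiteDimensional K
  let e : K ≃L[ℝ] EuclideanSpace ℝ (Fin (Module.finrank ℝ K)) :=
    ContinuousLinearEquiv.ofFinrankEq (by simp)
  let P : C₀(ℕ, E) →L[ℝ] EuclideanSpace ℝ (Fin (Module.finrank ℝ K)) :=
    (e : K →L[ℝ] _).comp pr
  have hPinj : ∀ ζ ∈ K, P ζ = 0 → ζ = 0 := fun ζ hζ h => by
    have h1 : pr ζ = 0 := e.map_eq_zero_iff.1 h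
    have h2 := hpr ⟨ζ, hζ⟩
    rw [h1] at h2
    exact (congrArg Subtype.val h2).symm
  have hbij : Function.Bijective (L.prod P) := by
    constructor
    · rw [injective_iff_map_eq_zero]
      intro ζ hζ
      rw [ContinuousLinearMap.prod_apply, Prod.mk_eq_zero] at hζ
      exact hPinj ζ hζ.1 hζ.2
    · rintro ⟨w, h⟩
      obtain ⟨ζ, rfl⟩ := hLsurj w
      refine ⟨ζ + (e.symm (h - P ζ) : K), ?_⟩
      have h1 : L ((e.symm (h - P ζ) : K) : C₀(ℕ, E)) = 0 := (e.symm (h - P ζ)).2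
      have h2 : P ((e.symm (h - P ζ) : K) : C₀(ℕ, E)) = h - P ζ := by
        change e (pr _) = _
        rw [hpr, e.apply_symm_apply]
      rw [ContinuousLinearMap.prod_apply, map_add, map_add, h1, h2]
      simp
  let Ψ' : C₀(ℕ, E) ≃L[ℝ] C₀(ℕ, E) × EuclideanSpace ℝ (Fin (Module.finrank ℝ K)) :=
    ContinuousLinearEquiv.ofBijective (L.prod P) (LinearMap.ker_eq_bot.2 hbij.1)
      (LinearMap.range_eq_top.2 hbij.2)
  -- The orbit equation is completed by the coordinates of a projection onto the kernel, so that the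
  -- derivative at `0` becomes invertible; the orbits are the slice over `0` in the first factor.
  let Ψ : C₀(ℕ, E) → C₀(ℕ, E) × EuclideanSpace ℝ (Fin (Module.finrank ℝ K)) :=
    fun ζ => (shiftNull ℝ E ζ - rescaled b g ζ, P ζ)
  have hres := contDiffOn_rescaled hb0 hb1 hU hr hg hg0 hρ
  have hΨ : ContDiffOn ℝ r Ψ (ball 0 ρ) :=
    ((shiftNull ℝ E).contDiff.contDiffOn.sub hres).prodMk P.contDiff.contDiffOn
  have hΨ1 : ContDiffOn ℝ 1 Ψ (ball 0 ρ) := hΨ.of_le (by exact_mod_cast hr)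
  have h0ρ : (0 : C₀(ℕ, E)) ∈ ball (0 : C₀(ℕ, E)) ρ := mem_ball_self hρ0
  have hΨat : ContDiffAt ℝ r Ψ 0 := hΨ.contDiffAt (isOpen_ball.mem_nhds h0ρ)
  have hD0 : HasFDerivAt Ψ (Ψ' : C₀(ℕ, E) →L[ℝ] _) 0 := by
    have h1 := hasFDerivAt_rescaled hb0 hb1 hb hU hg1 hg0 hρ (ζ := 0) (by simpa using hρ0)
    have h2 : rescaledDeriv b hb g 0 = mapNull T := by
      ext ξ n
      rw [rescaledDeriv_apply hb hU hg1 hρ (by simpa using hρ0.le), mapNull_apply]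
      simp [hTdef]
    rw [h2] at h1
    exact ((shiftNull ℝ E).hasFDerivAt.sub h1).prodMk P.hasFDerivAt
  have hr0 : (r : ℕ∞ω) ≠ 0 := by
    have : r ≠ 0 := (zero_lt_one.trans_le hr).ne'
    exact_mod_cast this
  let Θ := hΨat.toOpenPartialHomeomorph Ψ hD0 hr0
  have hΘ : ∀ ζ, Θ ζ = Ψ ζ := fun ζ => rfl
  have h0Θ : (0 : C₀(ℕ, E)) ∈ Θ.source := hΨat.mem_toOpenPartialHomeomorph_source hD0 hr0
  have hcont : ContinuousAt (fderiv ℝ Ψ) 0 :=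
    (hΨ1.continuousOn_fderiv_of_isOpen isOpen_ball le_rfl).continuousAt
      (isOpen_ball.mem_nhds h0ρ)
  -- The inverse must be `C^r` on a whole neighbourhood and not only at the image of `0`, so the
  -- domain is shrunk to points where the derivative of `Ψ` is invertible.
  have hinv : ∀ᶠ ζ in 𝓝 (0 : C₀(ℕ, E)), fderiv ℝ Ψ ζ ∈
      range ((↑) : (C₀(ℕ, E) ≃L[ℝ] C₀(ℕ, E) × EuclideanSpace ℝ (Fin (Module.finrank ℝ K))) →
        C₀(ℕ, E) →L[ℝ] C₀(ℕ, E) × EuclideanSpace ℝ (Fin (Module.finrank ℝ K))) := by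
    refine hcont.eventually ?_
    rw [hD0.fderiv]
    exact Ψ'.nhds
  obtain ⟨δ, hδ, hball⟩ := Metric.mem_nhds_iff.1 (inter_mem (inter_mem
    (Θ.open_source.mem_nhds h0Θ) hinv) (ball_mem_nhds 0 hρ0))
  let j : EuclideanSpace ℝ (Fin (Module.finrank ℝ K)) →
    C₀(ℕ, E) × EuclideanSpace ℝ (Fin (Module.finrank ℝ K)) := fun v => (0, v)
  have hj : ContDiff ℝ r j := contDiff_const.prodMk contDiff_id
  let V := j ⁻¹' (Θ.target ∩ Θ.symm ⁻¹' ball 0 (min δ ρ))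
  have hδ' : ∀ ζ : C₀(ℕ, E), ‖ζ‖ < min δ ρ → ζ ∈ ball (0 : C₀(ℕ, E)) δ := fun ζ hζ =>
    mem_ball_zero_iff.2 (hζ.trans_le (min_le_left _ _))
  refine ⟨_, V, fun v => Θ.symm (j v), P, min δ ρ, lt_min hδ hρ0, min_le_right _ _,
    (Θ.isOpen_inter_preimage_symm isOpen_ball).preimage hj.continuous, ?_, ?_, ?_, ?_⟩
  · intro v hv
    have hmem := hball (hδ' _ (mem_ball_zero_iff.1 hv.2))
    obtain ⟨A, hA⟩ := hmem.1.2
    have hΨv : ContDiffAt ℝ r Ψ (Θ.symm (j v)) := hΨ.contDiffAt (isOpen_ball.mem_nhds hmem.2)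
    have hd : HasFDerivAt Θ (A : C₀(ℕ, E) →L[ℝ] _) (Θ.symm (j v)) := by
      rw [hA]
      exact (hΨv.differentiableAt hr0).hasFDerivAt
    exact ((Θ.contDiffAt_symm hv.1 hd hΨv).comp v hj.contDiffAt).contDiffWithinAt
  · intro v hv
    have hlt := mem_ball_zero_iff.1 hv.2
    refine ⟨hlt, ?_⟩
    rw [isRescaledOrbit_iff hb0 hb1 hU hg1 hg0 hρ (hlt.le.trans (min_le_right _ _))]
    exact congrArg Prod.fst (Θ.right_inv hv.1)
  · intro ζ hζ horb
    rw [isRescaledOrbit_iff hb0 hb1 hU hg1 hg0 hρ (hζ.le.trans (min_le_right _ _))] at horb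
    have hs := (hball (hδ' _ hζ)).1.1
    have hΘζ : Θ ζ = j (P ζ) := Prod.ext horb rfl
    have hback : Θ.symm (j (P ζ)) = ζ := by rw [← hΘζ, Θ.left_inv hs]
    refine ⟨⟨?_, ?_⟩, hback⟩
    · rw [← hΘζ]
      exact Θ.map_source hs
    · rw [mem_preimage, hback]
      exact mem_ball_zero_iff.2 hζ
  · intro v hv
    exact congrArg Prod.snd (Θ.right_inv hv.1)

end LocalStable

end ConformallySymplectic

end

noncomputable section

namespace ConformallySymplectic

open scoped BoundedContinuousFunction ZeroAtInfty
open Filter Set Metric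

/-! ### Inverse functions and the local normal form of an immersion. -/

section Straightening

variable {E F : Type*} [NormedAddCommGroup E] [NormedSpace ℝ E] [FiniteDimensional ℝ E]
  [NormedAddCommGroup F] [NormedSpace ℝ F] [FiniteDimensional ℝ F]

omit [FiniteDimensional ℝ F] in
/-- A `C^r` map whose derivative is invertible at a point restricts to a `C^r` diffeomorphism between
open sets. -/
lemma exists_openPartialHomeomorph_contDiffOn {r : ℕ∞} (hr : 1 ≤ r) {h : E → F} {O : Set E}
    (hO : IsOpen O) (hh : ContDiffOn ℝ r h O) {x : E} (hx : x ∈ O) (A : E ≃L[ℝ] F)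
    (hA : HasFDerivAt h (A : E →L[ℝ] F) x) :
    ∃ Θ : OpenPartialHomeomorph E F, x ∈ Θ.source ∧ Θ.source ⊆ O ∧ (∀ y, Θ y = h y) ∧
      ContDiffOn ℝ r Θ.symm Θ.target := by
  have hr0 : (r : ℕ∞ω) ≠ 0 := by
    have : r ≠ 0 := (zero_lt_one.trans_le hr).ne'
    exact_mod_cast this
  have hat : ContDiffAt ℝ r h x := hh.contDiffAt (hO.mem_nhds hx)
  let Θ := hat.toOpenPartialHomeomorph h hA hr0
  have hxΘ : x ∈ Θ.source := hat.mem_toOpenPartialHomeomorph_source hA hr0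
  have hc : ContinuousOn (fderiv ℝ h) O := hh.continuousOn_fderiv_of_isOpen hO (by exact_mod_cast hr)
  have hW := hc.isOpen_inter_preimage hO (ContinuousLinearEquiv.isOpen (𝕜 := ℝ) (E := E) (F := F))
  refine ⟨Θ.restrOpen _ hW, ?_, ?_, fun y => rfl, ?_⟩
  · rw [OpenPartialHomeomorph.restrOpen_source]
    refine ⟨hxΘ, hx, ?_⟩
    rw [mem_preimage, hA.fderiv]
    exact mem_range_self A
  · rw [OpenPartialHomeomorph.restrOpen_source]
    exact fun y hy => hy.2.1
  · intro z hz
    have hs := (Θ.restrOpen _ hW).map_target hz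
    rw [OpenPartialHomeomorph.restrOpen_source] at hs
    obtain ⟨-, hO', B, hB⟩ := hs
    have hd := ((hh.contDiffAt (hO.mem_nhds hO')).differentiableAt hr0).hasFDerivAt
    rw [← hB] at hd
    exact ((Θ.restrOpen _ hW).contDiffAt_symm hz hd
      (hh.contDiffAt (hO.mem_nhds hO'))).contDiffWithinAt

/-- A `C^r` map with injective derivative at a point is a linear inclusion there, up to a `C^r`
diffeomorphism of the target. -/
lemma exists_straightening {r : ℕ∞} (hr : 1 ≤ r) {h : E → F} {O : Set E}
    (hO : IsOpen O) (hh : ContDiffOn ℝ r h O) {x : E} (hx : x ∈ O)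
    (hinj : Function.Injective (fderiv ℝ h x)) :
    ∃ (C : Submodule ℝ F) (A : (E × C) ≃L[ℝ] F) (φ : OpenPartialHomeomorph F F),
      h x ∈ φ.source ∧ ContDiffOn ℝ r φ φ.source ∧ ContDiffOn ℝ r φ.symm φ.target ∧
      ∃ O' ⊆ O, IsOpen O' ∧ x ∈ O' ∧ ∀ y ∈ O', h y ∈ φ.source ∧ φ (h y) = A (y, 0) := by
  have hr0 : (r : ℕ∞ω) ≠ 0 := by
    have : r ≠ 0 := (zero_lt_one.trans_le hr).ne'
    exact_mod_cast this
  set D := fderiv ℝ h x with hD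
  obtain ⟨C, hC⟩ := Submodule.exists_isCompl (LinearMap.range (D : E →ₗ[ℝ] F))
  let L : (E × C) →L[ℝ] F := D.coprod C.subtypeL
  have hLinj : Function.Injective L := by
    rw [injective_iff_map_eq_zero]
    rintro ⟨u, c⟩ huc
    have huc' : D u + (c : F) = 0 := huc
    have hcR : (c : F) ∈ LinearMap.range (D : E →ₗ[ℝ] F) :=
      ⟨-u, by simpa using (eq_neg_of_add_eq_zero_right huc').symm⟩
    have hc0 : (c : F) = 0 := by
      have := (Submodule.disjoint_def.1 hC.disjoint) _ hcR c.2
      exact this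
    rw [hc0, add_zero] at huc'
    exact Prod.ext (hinj (huc'.trans (map_zero D).symm)) (Subtype.ext hc0)
  have hLsurj : Function.Surjective L := by
    intro w
    have hw : w ∈ LinearMap.range (D : E →ₗ[ℝ] F) ⊔ C := by
      rw [hC.sup_eq_top]; trivial
    obtain ⟨_, ⟨u, rfl⟩, c, hc, rfl⟩ := Submodule.mem_sup.1 hw
    exact ⟨(u, ⟨c, hc⟩), rfl⟩
  let A : (E × C) ≃L[ℝ] F := ContinuousLinearEquiv.ofBijective L (LinearMap.ker_eq_bot.2 hLinj)
    (LinearMap.range_eq_top.2 hLsurj)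
  -- Thickening `h` along a complement `C` of the range of its derivative makes it a local
  -- diffeomorphism, whose inverse followed by the linear map `A` straightens the image of `h`.
  let H : E × C → F := fun p => h p.1 + p.2
  have hH : ContDiffOn ℝ r H (Prod.fst ⁻¹' O) :=
    (hh.comp contDiff_fst.contDiffOn (fun p hp => hp)).add
      (C.subtypeL.contDiff.comp contDiff_snd).contDiffOn
  have hDh : HasFDerivAt h D x := ((hh.contDiffAt (hO.mem_nhds hx)).differentiableAt hr0).hasFDerivAt
  have hHd : HasFDerivAt H (A : (E × C) →L[ℝ] F) (x, 0) := by
    have h1 : HasFDerivAt (fun p : E × C => h p.1) (D.comp (ContinuousLinearMap.fst ℝ E C)) (x, 0) :=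
      HasFDerivAt.comp (x, (0 : C)) (g := h) hDh hasFDerivAt_fst
    have h2 : HasFDerivAt (fun p : E × C => (p.2 : F))
        (C.subtypeL.comp (ContinuousLinearMap.snd ℝ E C)) (x, 0) :=
      (C.subtypeL.comp (ContinuousLinearMap.snd ℝ E C)).hasFDerivAt
    have hAeq : (A : (E × C) →L[ℝ] F) = D.comp (ContinuousLinearMap.fst ℝ E C)
        + C.subtypeL.comp (ContinuousLinearMap.snd ℝ E C) := by
      ext p
      · simp [A, L]
      · simp [A, L]
    rw [hAeq]
    exact h1.add h2
  obtain ⟨Θ, hxΘ, hΘO, hΘ, hΘs⟩ := exists_openPartialHomeomorph_contDiffOn hr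
    (hO.preimage continuous_fst) hH (x := (x, 0)) hx A hHd
  let φ : OpenPartialHomeomorph F F := Θ.symm.trans A.toHomeomorph.toOpenPartialHomeomorph
  have hφs : φ.source = Θ.target := by simp [φ]
  have hj : Continuous fun y : E => (y, (0 : C)) := by fun_prop
  refine ⟨C, A, φ, ?_, ?_, ?_, (fun y : E => (y, (0 : C))) ⁻¹' Θ.source, ?_,
    Θ.open_source.preimage hj, hxΘ, ?_⟩
  · rw [hφs]
    simpa [hΘ, H] using Θ.map_source hxΘ
  · rw [hφs]
    exact A.contDiff.comp_contDiffOn hΘs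
  · have hH' : ContDiffOn ℝ r Θ Θ.source := (hH.mono hΘO).congr fun y _ => hΘ y
    refine hH'.comp A.symm.contDiff.contDiffOn fun y hy => ?_
    simpa [φ] using hy
  · exact fun y hy => hΘO hy
  · intro y hy
    have h1 : h y = Θ (y, 0) := by simp [hΘ, H]
    refine ⟨by rw [hφs, h1]; exact Θ.map_source hy, ?_⟩
    change A (Θ.symm (h y)) = A (y, 0)
    rw [h1, Θ.left_inv hy]

end Straightening

/-! ### Immersions recognized by injectivity of the differential. -/

section Immersion

universe w
variable {E : Type*} [NormedAddCommGroup E] [NormedSpace ℝ E] [FiniteDimensional ℝ E]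
  {F : Type w} [NormedAddCommGroup F] [NormedSpace ℝ F] [FiniteDimensional ℝ F]
  {N : Type*} [TopologicalSpace N] [ChartedSpace E N]
  {M : Type*} [TopologicalSpace M] [ChartedSpace F M]

/-- A `C^r` map between finite-dimensional manifolds whose differential at `p` is injective is an
immersion at `p`. -/
theorem isImmersionAtOfComplement_of_injective_mfderiv {r : ℕ∞} (hr : 1 ≤ r)
    [IsManifold 𝓘(ℝ, E) r N] [IsManifold 𝓘(ℝ, F) r M] {ι : N → M}
    (hι : ContMDiff 𝓘(ℝ, E) 𝓘(ℝ, F) r ι) {p : N}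
    (hinj : Function.Injective (mfderiv 𝓘(ℝ, E) 𝓘(ℝ, F) ι p))
    (G : Type*) [NormedAddCommGroup G] [NormedSpace ℝ G] [FiniteDimensional ℝ G]
    (hG : Module.finrank ℝ E + Module.finrank ℝ G = Module.finrank ℝ F) :
    Manifold.IsImmersionAtOfComplement G 𝓘(ℝ, E) 𝓘(ℝ, F) r ι p := by
  have hr0 : (r : ℕ∞ω) ≠ 0 := by
    have : r ≠ 0 := (zero_lt_one.trans_le hr).ne'
    exact_mod_cast this
  set a := chartAt E p with ha
  set c := chartAt F (ι p) with hc
  let S : Set N := a.source ∩ ι ⁻¹' c.source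
  have hS : IsOpen S := a.open_source.inter (c.open_source.preimage hι.continuous)
  have hpS : p ∈ S := ⟨mem_chart_source _ _, mem_chart_source _ _⟩
  let O : Set E := a.target ∩ a.symm ⁻¹' S
  have hO : IsOpen O := a.isOpen_inter_preimage_symm hS
  let h : E → F := c ∘ ι ∘ a.symm
  have hpO : a p ∈ O := ⟨a.map_source hpS.1, by
    rw [mem_preimage, a.left_inv hpS.1]; exact hpS⟩
  have hh : ContDiffOn ℝ r h O := by
    rw [← contMDiffOn_iff_contDiffOn]
    have h1 : ContMDiffOn 𝓘(ℝ, E) 𝓘(ℝ, E) r a.symm a.target := contMDiffOn_chart_symm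
    have h2 : ContMDiffOn 𝓘(ℝ, F) 𝓘(ℝ, F) r c c.source := contMDiffOn_chart
    exact h2.comp (hι.comp_contMDiffOn (h1.mono inter_subset_left)) fun y hy => hy.2.2
  have hmd : MDifferentiableAt 𝓘(ℝ, E) 𝓘(ℝ, F) ι p := hι.mdifferentiableAt hr0
  have hinj' : Function.Injective (fderiv ℝ h (a p)) := by
    have : mfderiv 𝓘(ℝ, E) 𝓘(ℝ, F) ι p = fderiv ℝ h (a p) := by
      rw [hmd.mfderiv]
      simp only [writtenInExtChartAt, extChartAt, mfld_simps, fderivWithin_univ]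
      rfl
    rwa [this] at hinj
  obtain ⟨C, A, φ, hφp, hφ, hφs, O', hO'O, hO', hpO', heq⟩ :=
    exists_straightening hr hO hh hpO hinj'
  have hdim : Module.finrank ℝ C = Module.finrank ℝ G := by
    have := A.toLinearEquiv.finrank_eq
    rw [Module.finrank_prod] at this
    omega
  -- The complement `C` varies with the point; it is exchanged for the fixed model `G` of the same
  -- dimension.
  refine Manifold.IsImmersionAtOfComplement.trans_F ?_ (ContinuousLinearEquiv.ofFinrankEq hdim)
  have hS' : IsOpen (a.source ∩ a ⁻¹' O') := a.isOpen_inter_preimage hO'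
  refine Manifold.IsImmersionAtOfComplement.mk_of_continuousAt hι.continuous.continuousAt A
    (a.restrOpen _ hS') (c.trans φ) ?_ ?_ ?_ ?_ ?_
  · rw [OpenPartialHomeomorph.restrOpen_source]
    exact ⟨hpS.1, hpS.1, hpO'⟩
  · rw [OpenPartialHomeomorph.trans_source]
    refine ⟨hpS.2, ?_⟩
    have : h (a p) = c (ι p) := by simp only [h, Function.comp_apply, a.left_inv hpS.1]
    rwa [this] at hφp
  · apply OpenPartialHomeomorph.mem_maximalAtlas_of_contMDiffOn
    · exact (contMDiffOn_chart (I := 𝓘(ℝ, E)) (n := r) (x := p)).mono fun y hy => by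
        rw [OpenPartialHomeomorph.restrOpen_source] at hy
        exact hy.1
    · exact (contMDiffOn_chart_symm (I := 𝓘(ℝ, E)) (n := r) (x := p)).mono fun y hy => hy.1
  · apply OpenPartialHomeomorph.mem_maximalAtlas_of_contMDiffOn
    · rw [← contMDiffOn_iff_contDiffOn] at hφ
      refine hφ.comp ((contMDiffOn_chart (I := 𝓘(ℝ, F)) (n := r) (x := ι p)).mono ?_) ?_
      · exact fun y hy => hy.1
      · exact fun y hy => hy.2
    · rw [← contMDiffOn_iff_contDiffOn] at hφs
      refine (contMDiffOn_chart_symm (I := 𝓘(ℝ, F)) (n := r) (x := ι p)).comp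
        (hφs.mono ?_) ?_
      · exact fun y hy => hy.1
      · exact fun y hy => hy.2
  · intro y hy
    have hy1 : y ∈ a.target ∧ a.symm y ∈ a.source ∩ a ⁻¹' O' := by
      simpa using hy
    have hy2 : y ∈ O' := by
      have := hy1.2.2
      rwa [mem_preimage, a.right_inv hy1.1] at this
    exact (heq y hy2).2

/-- A `C^r` map between finite-dimensional manifolds whose differentials are injective is an
immersion. -/
theorem isImmersion_of_injective_mfderiv {r : ℕ∞} (hr : 1 ≤ r) [IsManifold 𝓘(ℝ, E) r N]
    [IsManifold 𝓘(ℝ, F) r M] {ι : N → M} (hι : ContMDiff 𝓘(ℝ, E) 𝓘(ℝ, F) r ι)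
    (hinj : ∀ p, Function.Injective (mfderiv 𝓘(ℝ, E) 𝓘(ℝ, F) ι p)) :
    Manifold.IsImmersion 𝓘(ℝ, E) 𝓘(ℝ, F) r ι := by
  rcases isEmpty_or_nonempty N with hN | ⟨⟨p⟩⟩
  · exact ⟨PUnit, inferInstance, inferInstance, fun p => hN.elim p⟩
  · let D : E →L[ℝ] F := mfderiv 𝓘(ℝ, E) 𝓘(ℝ, F) ι p
    have hD : Function.Injective (D : E →ₗ[ℝ] F) := hinj p
    obtain ⟨C, hC⟩ := Submodule.exists_isCompl (LinearMap.range (D : E →ₗ[ℝ] F))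
    refine ⟨C, inferInstance, inferInstance, fun q =>
      isImmersionAtOfComplement_of_injective_mfderiv hr hι (hinj q) C ?_⟩
    rw [← Submodule.finrank_add_eq_of_isCompl hC, LinearMap.finrank_range_of_inj hD]

end Immersion

end ConformallySymplectic

end

noncomputable section

namespace ConformallySymplectic

open scoped BoundedContinuousFunction ZeroAtInfty
open Filter Set Metric

/-! ### Global inverses of injective local diffeomorphisms. -/

section InverseOn

variable {E : Type*} [NormedAddCommGroup E] [NormedSpace ℝ E] [FiniteDimensional ℝ E]

/-- An injective `C^r` map with injective derivatives between spaces of equal dimension is an open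
map with `C^r` inverse. -/
lemma isOpen_image_and_contDiffOn_invFunOn {r : ℕ∞} (hr : 1 ≤ r) {θ : E → E} {V : Set E}
    (hV : IsOpen V) (hθ : ContDiffOn ℝ r θ V) (hinj : InjOn θ V)
    (hd : ∀ v ∈ V, Function.Injective (fderiv ℝ θ v)) :
    IsOpen (θ '' V) ∧ ContDiffOn ℝ r (Function.invFunOn θ V) (θ '' V) := by
  have hr0 : (r : ℕ∞ω) ≠ 0 := by
    have : r ≠ 0 := (zero_lt_one.trans_le hr).ne'
    exact_mod_cast this
  have key : ∀ v ∈ V, ∃ O ⊆ θ '' V, IsOpen O ∧ θ v ∈ O ∧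
      ContDiffOn ℝ r (Function.invFunOn θ V) O := by
    intro v hv
    let A : E ≃L[ℝ] E := ContinuousLinearEquiv.ofBijective (fderiv ℝ θ v)
      (LinearMap.ker_eq_bot.2 (hd v hv))
      (LinearMap.range_eq_top.2 ((LinearMap.injective_iff_surjective
        (f := (fderiv ℝ θ v : E →ₗ[ℝ] E))).1 (hd v hv)))
    have hA : HasFDerivAt θ (A : E →L[ℝ] E) v :=
      ((hθ.contDiffAt (hV.mem_nhds hv)).differentiableAt hr0).hasFDerivAt
    obtain ⟨Θ, hvΘ, hΘV, hΘ, hΘs⟩ := exists_openPartialHomeomorph_contDiffOn hr hV hθ hv A hA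
    have himg : ∀ z ∈ Θ.target, θ (Θ.symm z) = z := fun z hz => by rw [← hΘ, Θ.right_inv hz]
    refine ⟨Θ.target, fun z hz => ⟨_, hΘV (Θ.map_target hz), himg z hz⟩, Θ.open_target, ?_, ?_⟩
    · rw [← hΘ]
      exact Θ.map_source hvΘ
    · refine hΘs.congr fun z hz => ?_
      have hz' : z ∈ θ '' V := ⟨_, hΘV (Θ.map_target hz), himg z hz⟩
      exact hinj (Function.invFunOn_mem hz') (hΘV (Θ.map_target hz))
        ((Function.invFunOn_eq hz').trans (himg z hz).symm)
  constructor
  · rw [isOpen_iff_forall_mem_open]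
    rintro _ ⟨v, hv, rfl⟩
    obtain ⟨O, hO, hOo, hvO, -⟩ := key v hv
    exact ⟨O, hO, hOo, hvO⟩
  · rintro _ ⟨v, hv, rfl⟩
    obtain ⟨O, hO, hOo, hvO, hc⟩ := key v hv
    exact (hc.contDiffAt (hOo.mem_nhds hvO)).contDiffWithinAt

end InverseOn

/-! ### Gluing an increasing union of parametrized pieces. -/

section Union

universe u w
variable {E : Type*} [NormedAddCommGroup E] [NormedSpace ℝ E] [FiniteDimensional ℝ E]
  {F : Type w} [NormedAddCommGroup F] [NormedSpace ℝ F] [FiniteDimensional ℝ F]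
  {M : Type u} [TopologicalSpace M] [ChartedSpace F M]

/-- The inverse of an injective parametrization `q n : V → M`, as a chart of the union of the images
of all `q n`. -/
def unionChart {q : ℕ → E → M} {V : Set E} (hV : V.Nonempty) (hq : ∀ n, InjOn (q n) V) (n : ℕ) :
    PartialEquiv (⋃ n, q n '' V) E where
  toFun y := Function.invFunOn (q n) V y
  invFun v := open Classical in if h : v ∈ V then ⟨q n v, mem_iUnion.2 ⟨n, v, h, rfl⟩⟩
    else ⟨q n hV.some, mem_iUnion.2 ⟨n, _, hV.some_mem, rfl⟩⟩
  source := {y | (y : M) ∈ q n '' V}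
  target := V
  map_source' _ hy := Function.invFunOn_mem hy
  map_target' v hv := by
    rw [dif_pos hv]
    exact ⟨v, hv, rfl⟩
  left_inv' y hy := by
    rw [dif_pos (Function.invFunOn_mem hy)]
    exact Subtype.ext (Function.invFunOn_eq hy)
  right_inv' v hv := by
    rw [dif_pos hv]
    exact (hq n).leftInvOn_invFunOn hv

variable {q : ℕ → E → M} {V : Set E} {τ : E → E}

omit [NormedSpace ℝ E] [FiniteDimensional ℝ E] [TopologicalSpace M] in
lemma unionChart_symm_apply (hV : V.Nonempty) (hq : ∀ n, InjOn (q n) V) (n : ℕ) {v : E}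
    (hv : v ∈ V) : ((unionChart hV hq n).symm v : M) = q n v := by
  change ((unionChart hV hq n).invFun v : M) = q n v
  simp only [unionChart]
  rw [dif_pos hv]

omit [NormedSpace ℝ E] [FiniteDimensional ℝ E] [TopologicalSpace M] in
lemma apply_unionChart (hV : V.Nonempty) (hq : ∀ n, InjOn (q n) V) (n : ℕ)
    {y : ⋃ n, q n '' V} (hy : y ∈ (unionChart hV hq n).source) :
    q n (unionChart hV hq n y) = y := Function.invFunOn_eq (f := q n) (s := V) hy

omit [FiniteDimensional ℝ F] in
/-- The changes of coordinates on the union of the images of compatible parametrizations. -/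
lemma unionChart_transition {r : ℕ∞} (hr : 1 ≤ r) [IsManifold 𝓘(ℝ, F) r M] (hVo : IsOpen V)
    (hV : V.Nonempty) (hq : ∀ n, InjOn (q n) V) (hqs : ∀ n, ContMDiffOn 𝓘(ℝ, E) 𝓘(ℝ, F) r (q n) V)
    (hqd : ∀ n, ∀ v ∈ V, Function.Injective (mfderiv 𝓘(ℝ, E) 𝓘(ℝ, F) (q n) v))
    (hτ : ContDiffOn ℝ r τ V) (hτV : MapsTo τ V V) (hqτ : ∀ n, ∀ v ∈ V, q n v = q (n + 1) (τ v))
    (n m : ℕ) :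
    IsOpen ((unionChart hV hq n).symm.trans (unionChart hV hq m)).source ∧
      ContDiffOn ℝ r ((unionChart hV hq n).symm.trans (unionChart hV hq m))
        ((unionChart hV hq n).symm.trans (unionChart hV hq m)).source := by
  have hr0 : (r : ℕ∞ω) ≠ 0 := by
    have : r ≠ 0 := (zero_lt_one.trans_le hr).ne'
    exact_mod_cast this
  have hiter : ∀ p, ContDiffOn ℝ r τ^[p] V ∧ MapsTo τ^[p] V V ∧
      ∀ n, ∀ v ∈ V, q n v = q (n + p) (τ^[p] v) := by
    intro p
    induction p with
    | zero => exact ⟨contDiffOn_id, mapsTo_id _, fun _ _ _ => rfl⟩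
    | succ p ih =>
      rw [Function.iterate_succ']
      refine ⟨hτ.comp ih.1 ih.2.1, hτV.comp ih.2.1, fun n v hv => ?_⟩
      rw [ih.2.2 n v hv, hqτ _ _ (ih.2.1 hv)]
      rfl
  have hsource : ∀ n m, ((unionChart hV hq n).symm.trans (unionChart hV hq m)).source
      = {v | v ∈ V ∧ q n v ∈ q m '' V} := by
    intro n m
    ext v
    rw [PartialEquiv.trans_source, PartialEquiv.symm_source]
    refine and_congr_right fun hv => ?_
    change ((unionChart hV hq n).symm v : M) ∈ q m '' V ↔ _
    rw [unionChart_symm_apply hV hq n hv]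
  have happly : ∀ n m v, v ∈ V → ((unionChart hV hq n).symm.trans (unionChart hV hq m)) v
      = Function.invFunOn (q m) V (q n v) := by
    intro n m v hv
    change Function.invFunOn (q m) V ((unionChart hV hq n).symm v : M) = _
    rw [unionChart_symm_apply hV hq n hv]
  -- Since `q n = q (n + p) ∘ τ^[p]` on `V`, a change of coordinates is `τ^[p]` when the index
  -- increases by `p`, and the inverse of `τ^[p]` on its open image when it decreases by `p`.
  rcases le_total n m with h | h
  · obtain ⟨p, rfl⟩ := Nat.exists_eq_add_of_le h
    obtain ⟨hs, hm, hc⟩ := hiter p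
    have hsrc : {v | v ∈ V ∧ q n v ∈ q (n + p) '' V} = V := by
      ext v
      exact ⟨fun hv => hv.1, fun hv => ⟨hv, _, hm hv, (hc n v hv).symm⟩⟩
    rw [hsource, hsrc]
    refine ⟨hVo, hs.congr fun v hv => ?_⟩
    rw [happly _ _ v hv, hc n v hv]
    exact (hq (n + p)).leftInvOn_invFunOn (hm hv)
  · obtain ⟨p, rfl⟩ := Nat.exists_eq_add_of_le h
    obtain ⟨hs, hm, hc⟩ := hiter p
    have hinj : InjOn τ^[p] V := fun v hv w hw hvw => hq m hv hw (by
      rw [hc m v hv, hc m w hw, hvw])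
    have hd : ∀ v ∈ V, Function.Injective (fderiv ℝ τ^[p] v) := by
      intro v hv
      have h1 : q m =ᶠ[𝓝 v] q (m + p) ∘ τ^[p] := by
        filter_upwards [hVo.mem_nhds hv] with w hw using hc m w hw
      have h2 : MDifferentiableAt 𝓘(ℝ, E) 𝓘(ℝ, F) (q (m + p)) (τ^[p] v) :=
        ((hqs (m + p)).contMDiffAt (hVo.mem_nhds (hm hv))).mdifferentiableAt hr0
      have h3 : MDifferentiableAt 𝓘(ℝ, E) 𝓘(ℝ, E) τ^[p] v :=
        ((hs.contDiffAt (hVo.mem_nhds hv)).differentiableAt hr0).mdifferentiableAt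
      -- The differential of `q m` factors through that of `τ^[p]`, so the latter inherits its
      -- injectivity.
      have h4 := mfderiv_comp v h2 h3
      rw [← h1.mfderiv_eq, mfderiv_eq_fderiv] at h4
      have h5 := hqd m v hv
      intro a b hab
      refine h5 ?_
      rw [h4]
      exact congrArg (mfderiv 𝓘(ℝ, E) 𝓘(ℝ, F) (q (m + p)) (τ^[p] v)) hab
    have hsrc : {v | v ∈ V ∧ q (m + p) v ∈ q m '' V} = τ^[p] '' V := by
      ext v
      constructor
      · rintro ⟨hv, w, hw, hwv⟩
        rw [hc m w hw] at hwv
        exact ⟨w, hw, hq (m + p) (hm hw) hv hwv⟩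
      · rintro ⟨w, hw, rfl⟩
        exact ⟨hm hw, w, hw, hc m w hw⟩
    rw [hsource, hsrc]
    obtain ⟨ho, hi⟩ := isOpen_image_and_contDiffOn_invFunOn hr hVo hs hinj hd
    refine ⟨ho, hi.congr ?_⟩
    rintro _ ⟨w, hw, rfl⟩
    rw [happly _ _ _ (hm hw), ← hc m w hw, (hq m).leftInvOn_invFunOn hw,
      hinj.leftInvOn_invFunOn hw]

/-- An increasing union of injectively immersed open sets is an injectively immersed manifold. -/
theorem exists_immersed_union {r : ℕ∞} (hr : 1 ≤ r) [T2Space M] [IsManifold 𝓘(ℝ, F) r M]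
    (hVo : IsOpen V)
    (hV : V.Nonempty) (hq : ∀ n, InjOn (q n) V) (hqs : ∀ n, ContMDiffOn 𝓘(ℝ, E) 𝓘(ℝ, F) r (q n) V)
    (hqd : ∀ n, ∀ v ∈ V, Function.Injective (mfderiv 𝓘(ℝ, E) 𝓘(ℝ, F) (q n) v))
    (hτ : ContDiffOn ℝ r τ V) (hτV : MapsTo τ V V)
    (hqτ : ∀ n, ∀ v ∈ V, q n v = q (n + 1) (τ v)) :
    ∃ (N : Type u) (_ : TopologicalSpace N) (_ : ChartedSpace E N) (ι : N → M),
      T2Space N ∧ SecondCountableTopology N ∧ IsManifold 𝓘(ℝ, E) r N ∧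
      Manifold.IsImmersion 𝓘(ℝ, E) 𝓘(ℝ, F) r ι ∧ Function.Injective ι ∧
      range ι = ⋃ n, q n '' V ∧
      ∀ p, ∃ (n : ℕ) (e : N → E), e p ∈ V ∧ MDifferentiableAt 𝓘(ℝ, E) 𝓘(ℝ, E) e p ∧
        ι =ᶠ[𝓝 p] q n ∘ e := by
  have hr0 : (r : ℕ∞ω) ≠ 0 := by
    have : r ≠ 0 := (zero_lt_one.trans_le hr).ne'
    exact_mod_cast this
  have htrans := unionChart_transition hr hVo hV hq hqs hqd hτ hτV hqτ
  choose idx hidx using fun y : ⋃ n, q n '' V => mem_iUnion.1 y.2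
  -- The topology is the one generated by the charts, in general finer than the subspace topology of
  -- `M`.
  let core : ChartedSpaceCore E (⋃ n, q n '' V) :=
    { atlas := range (unionChart hV hq)
      chartAt := fun y => unionChart hV hq (idx y)
      mem_chart_source := fun y => hidx y
      chart_mem_atlas := fun y => mem_range_self _
      open_source := by
        rintro _ _ ⟨n, rfl⟩ ⟨m, rfl⟩
        exact (htrans n m).1
      continuousOn_toFun := by
        rintro _ _ ⟨n, rfl⟩ ⟨m, rfl⟩
        exact (htrans n m).2.continuousOn }
  let : TopologicalSpace (⋃ n, q n '' V) := core.toTopologicalSpace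
  let : ChartedSpace E (⋃ n, q n '' V) := core.toChartedSpace
  have hchart : ∀ y z : ⋃ n, q n '' V, extChartAt 𝓘(ℝ, E) y z = unionChart hV hq (idx y) z :=
    fun y z => rfl
  have hsrc : ∀ y : ⋃ n, q n '' V, (chartAt E y).source = (unionChart hV hq (idx y)).source :=
    fun y => rfl
  have hman : IsManifold 𝓘(ℝ, E) r (⋃ n, q n '' V) := by
    refine isManifold_of_contDiffOn _ _ _ fun e e' he he' => ?_
    obtain ⟨_, ⟨n, rfl⟩, rfl⟩ := mem_iUnion₂.1 he
    obtain ⟨_, ⟨m, rfl⟩, rfl⟩ := mem_iUnion₂.1 he'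
    rw [ModelWithCorners.range_eq_univ, inter_univ]
    exact (htrans n m).2
  have hev : ∀ p : ⋃ n, q n '' V, (Subtype.val : (⋃ n, q n '' V) → M) =ᶠ[𝓝 p]
      q (idx p) ∘ extChartAt 𝓘(ℝ, E) p := fun p => by
    filter_upwards [chart_source_mem_nhds E p] with y hy
    exact (apply_unionChart hV hq (idx p) hy).symm
  have hmem : ∀ p : ⋃ n, q n '' V, extChartAt 𝓘(ℝ, E) p p ∈ V := fun p =>
    (unionChart hV hq (idx p)).map_source (hidx p)
  have hqat : ∀ p : ⋃ n, q n '' V, ContMDiffAt 𝓘(ℝ, E) 𝓘(ℝ, F) r (q (idx p))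
      (extChartAt 𝓘(ℝ, E) p p) := fun p => (hqs _).contMDiffAt (hVo.mem_nhds (hmem p))
  have hι : ContMDiff 𝓘(ℝ, E) 𝓘(ℝ, F) r (Subtype.val : (⋃ n, q n '' V) → M) := fun p =>
    ((hqat p).comp p contMDiffAt_extChartAt).congr_of_eventuallyEq (hev p)
  have hed : ∀ p : ⋃ n, q n '' V, MDifferentiableAt 𝓘(ℝ, E) 𝓘(ℝ, E)
      (extChartAt 𝓘(ℝ, E) p) p := fun p => contMDiffAt_extChartAt.mdifferentiableAt hr0
  have : IsManifold 𝓘(ℝ, E) 1 (⋃ n, q n '' V) := IsManifold.of_le (n := r) (by exact_mod_cast hr)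
  refine ⟨⋃ n, q n '' V, inferInstance, inferInstance, Subtype.val, ?_, ?_, hman, ?_,
    Subtype.val_injective, Subtype.range_val, fun p => ⟨idx p, extChartAt 𝓘(ℝ, E) p, hmem p, hed p,
      hev p⟩⟩
  · exact T2Space.of_injective_continuous Subtype.val_injective hι.continuous
  · have : Nonempty (⋃ n, q n '' V) := ⟨(unionChart hV hq 0).symm hV.some⟩
    refine ChartedSpace.secondCountable_of_countable_cover E
      -- Preferred charts depend on a point only through its index, so one point for each index that
      -- occurs gives a countable cover.
      (s := range (fun n => Function.invFun idx n)) ?_ (countable_range _)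
    refine eq_univ_of_forall fun y => mem_iUnion₂.2 ⟨_, mem_range_self (idx y), ?_⟩
    rw [hsrc, Function.invFun_eq (f := idx) ⟨y, rfl⟩]
    exact hidx y
  · refine isImmersion_of_injective_mfderiv hr hι fun p => ?_
    have h1 := mfderiv_comp p ((hqat p).mdifferentiableAt hr0) (hed p)
    rw [(hev p).mfderiv_eq, h1]
    refine (hqd _ _ (hmem p)).comp ?_
    exact (isInvertible_mfderiv_extChartAt (mem_extChartAt_source (I := 𝓘(ℝ, E)) p)).injective

end Union

end ConformallySymplectic

end

noncomputable section

namespace ConformallySymplectic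

open scoped BoundedContinuousFunction ZeroAtInfty
open Filter Set Metric

/-! ### Chart distance bounded by Riemannian distance. -/

section RiemannianComparison

open Manifold MeasureTheory
open scoped NNReal ENNReal

universe u
variable {F : Type*} [NormedAddCommGroup F] [NormedSpace ℝ F]
  {M : Type u} [TopologicalSpace M] [ChartedSpace F M] [IsManifold 𝓘(ℝ, F) 1 M]
  [Bundle.RiemannianBundle (fun x : M => TangentSpace 𝓘(ℝ, F) x)]
  [IsContinuousRiemannianBundle F (fun x : M => TangentSpace 𝓘(ℝ, F) x)]

attribute [local instance] normedAddCommGroupTangentSpaceVectorSpace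
attribute [local instance] normedSpaceTangentSpaceVectorSpace

/-- Near `x`, the distance to `x` in the extended chart is controlled by the Riemannian
distance to `x`. -/
lemma exists_edist_extChartAt_le_riemannianEDist [RegularSpace M] (x : M) :
    ∃ C : ℝ≥0, ∃ c > (0 : ℝ≥0), ∀ y, riemannianEDist 𝓘(ℝ, F) x y < c →
      y ∈ (extChartAt 𝓘(ℝ, F) x).source ∧
      edist (extChartAt 𝓘(ℝ, F) x x) (extChartAt 𝓘(ℝ, F) x y)
        ≤ C * riemannianEDist 𝓘(ℝ, F) x y := by
  obtain ⟨C, C_pos, hC⟩ := eventually_enorm_mfderiv_extChartAt_lt 𝓘(ℝ, F) x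
  obtain ⟨S, hSx, hS⟩ : ∃ S ∈ 𝓝 x, ∀ z ∈ S, ∀ u : TangentSpace 𝓘(ℝ, F) z,
      ‖(mfderiv 𝓘(ℝ, F) 𝓘(ℝ, F) (extChartAt 𝓘(ℝ, F) x) z u : F)‖ₑ ≤ C * ‖u‖ₑ := by
    refine ⟨_, hC, fun z hz u => ?_⟩
    refine (ContinuousLinearMap.le_opENorm (F := F) _ u).trans ?_
    exact mul_le_mul_left (le_of_lt hz) _
  obtain ⟨c, hc, hsub⟩ := setOfPred_riemannianEDist_lt_subset_nhds 𝓘(ℝ, F)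
    (inter_mem hSx (extChartAt_source_mem_nhds (I := 𝓘(ℝ, F)) x))
  refine ⟨C, c, hc, fun y hy => ⟨(hsub hy).2, ?_⟩⟩
  have key : ∀ R, riemannianEDist 𝓘(ℝ, F) x y < R → R < c →
      edist (extChartAt 𝓘(ℝ, F) x x) (extChartAt 𝓘(ℝ, F) x y) ≤ C * R := by
    intro R hyR hRc
    obtain ⟨γ, hγx, hγy, γ_smooth, hγ, -⟩ :=
      exists_lt_locally_constant_of_riemannianEDist_lt hyR zero_lt_one
    have hmem : ∀ t ∈ Icc (0 : ℝ) 1, γ t ∈ S ∩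
        (extChartAt 𝓘(ℝ, F) x).source := by
      intro t ht
      -- A path from `x` of length below `c` cannot leave the Riemannian ball of radius `c`, because
      -- the length of each initial piece bounds the distance reached. The derivative bound thus
      -- holds along the whole path.
      refine hsub (lt_of_le_of_lt ?_ (hγ.trans hRc))
      refine (riemannianEDist_le_pathELength γ_smooth.contMDiffOn hγx rfl ht.1).trans ?_
      exact pathELength_mono le_rfl ht.2
    have hsrc : MapsTo γ (Icc 0 1) (chartAt F x).source := fun t ht => by
      simpa [extChartAt_source 𝓘(ℝ, F) x] using (hmem t ht).2
    let γ' := extChartAt 𝓘(ℝ, F) x ∘ γ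
    have hγ' : CMDiff[Icc 0 1] 1 γ' :=
      contMDiffOn_extChartAt.comp (I' := 𝓘(ℝ, F)) (t := (chartAt F x).source)
        γ_smooth.contMDiffOn hsrc
    have h01 : edist (extChartAt 𝓘(ℝ, F) x x) (extChartAt 𝓘(ℝ, F) x y) = ‖γ' 1 - γ' 0‖ₑ := by
      rw [edist_comm, edist_eq_enorm_sub]
      simp [γ', hγx, hγy]
    rw [h01]
    calc
      ‖γ' 1 - γ' 0‖ₑ
    _ ≤ ∫⁻ t' in Icc 0 1, ‖derivWithin γ' (Icc 0 1) t'‖ₑ := by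
      apply enorm_sub_le_lintegral_derivWithin_Icc_of_contDiffOn_Icc _ zero_le_one
      rwa [← contMDiffOn_iff_contDiffOn]
    _ = ∫⁻ t' in Icc 0 1, ‖mfderiv[Icc 0 1] γ' t' 1‖ₑ := by
      simp_rw [← fderivWithin_derivWithin, mfderivWithin_eq_fderivWithin]
      rfl
    _ ≤ ∫⁻ t' in Icc 0 1, C * ‖mfderiv[Icc 0 1] γ t' 1‖ₑ := by
      apply setLIntegral_mono' measurableSet_Icc (fun t' ht' ↦ ?_)
      have : mfderiv[Icc 0 1] γ' t' =
          (mfderiv% (extChartAt 𝓘(ℝ, F) x) (γ t')) ∘L (mfderiv[Icc 0 1] γ t') := by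
        apply mfderiv_comp_mfderivWithin
        · exact mdifferentiableAt_extChartAt (hsrc ht')
        · exact (γ_smooth.mdifferentiable one_ne_zero).mdifferentiableOn _ ht'
        · rw [uniqueMDiffWithinAt_iff_uniqueDiffWithinAt]
          exact uniqueDiffOn_Icc zero_lt_one _ ht'
      have : mfderiv[Icc 0 1] γ' t' 1 =
          (mfderiv% (extChartAt 𝓘(ℝ, F) x) (γ t')) (mfderiv[Icc 0 1] γ t' 1) :=
        congr($this 1)
      rw [this]
      exact hS _ (hmem t' ht').1 _
    _ = C * pathELength 𝓘(ℝ, F) γ 0 1 := by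
      rw [lintegral_const_mul' _ _ ENNReal.coe_ne_top,
          pathELength_eq_lintegral_mfderivWithin_Icc]
    _ ≤ C * R := by
      gcongr
  -- The infimum over paths need not be attained, so `R` decreases to the distance.
  have hne : (𝓝[>] riemannianEDist 𝓘(ℝ, F) x y).NeBot := nhdsGT_neBot_of_exists_gt ⟨c, hy⟩
  have ht : Tendsto (fun R => (C : ℝ≥0∞) * R) (𝓝[>] riemannianEDist 𝓘(ℝ, F) x y)
      (𝓝 (C * riemannianEDist 𝓘(ℝ, F) x y)) :=
    (ENNReal.Tendsto.const_mul tendsto_id (Or.inr ENNReal.coe_ne_top)).mono_left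
      nhdsWithin_le_nhds
  refine ge_of_tendsto ht ?_
  filter_upwards [Ioo_mem_nhdsGT hy] with R hR using key R hR.1 hR.2

end RiemannianComparison

end ConformallySymplectic

end

noncomputable section

namespace ConformallySymplectic

open scoped BoundedContinuousFunction ZeroAtInfty
open Filter Set Metric

/-! ### The chart centred at the fixed point. -/

section CenteredChart

universe u
variable {F : Type*} [NormedAddCommGroup F] [NormedSpace ℝ F]
  {M : Type u} [TopologicalSpace M] [ChartedSpace F M]

/-- The chart at `x`, translated so that `x` is sent to `0`. -/
def centered (x y : M) : F := extChartAt 𝓘(ℝ, F) x y - extChartAt 𝓘(ℝ, F) x x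

/-- The inverse of the centered chart at `x`. -/
def centeredSymm (x : M) (v : F) : M :=
  (extChartAt 𝓘(ℝ, F) x).symm (v + extChartAt 𝓘(ℝ, F) x x)

/-- The domain of the inverse of the centered chart at `x`. -/
def centeredTarget (F : Type*) [NormedAddCommGroup F] [NormedSpace ℝ F] {M : Type u}
    [TopologicalSpace M] [ChartedSpace F M] (x : M) : Set F :=
  (fun v => v + extChartAt 𝓘(ℝ, F) x x) ⁻¹' (extChartAt 𝓘(ℝ, F) x).target

/-- The expression of `g` in the centered chart at `x`. -/
def localRep (F : Type*) [NormedAddCommGroup F] [NormedSpace ℝ F] {M : Type u}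
    [TopologicalSpace M] [ChartedSpace F M] (x : M) (g : M → M) (v : F) : F :=
  centered x (g (centeredSymm x v))

/-- The domain of the expression of `g` in the centered chart at `x`. -/
def localDomain (F : Type*) [NormedAddCommGroup F] [NormedSpace ℝ F] {M : Type u}
    [TopologicalSpace M] [ChartedSpace F M] (x : M) (g : M → M) : Set F :=
  centeredTarget F x ∩ (fun v => g (centeredSymm x v)) ⁻¹' (extChartAt 𝓘(ℝ, F) x).source

variable {x : M} {g : M → M}

lemma centered_self : centered x x = (0 : F) := sub_self _

lemma centeredSymm_zero : centeredSymm x (0 : F) = x := by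
  rw [centeredSymm, zero_add]
  exact extChartAt_to_inv x

lemma isOpen_centeredTarget : IsOpen (centeredTarget F x) :=
  (isOpen_extChartAt_target x).preimage (continuous_add_const _)

lemma zero_mem_centeredTarget : (0 : F) ∈ centeredTarget F x := by
  rw [centeredTarget, mem_preimage, zero_add]
  exact mem_extChartAt_target x

lemma centeredSymm_mem_source {v : F} (hv : v ∈ centeredTarget F x) :
    centeredSymm x v ∈ (extChartAt 𝓘(ℝ, F) x).source := (extChartAt 𝓘(ℝ, F) x).map_target hv

lemma centered_centeredSymm {v : F} (hv : v ∈ centeredTarget F x) :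
    centered x (centeredSymm x v) = v := by
  rw [centered, centeredSymm, (extChartAt 𝓘(ℝ, F) x).right_inv hv, add_sub_cancel_right]

lemma centeredSymm_centered {y : M} (hy : y ∈ (extChartAt 𝓘(ℝ, F) x).source) :
    centeredSymm x (centered x y : F) = y := by
  rw [centered, centeredSymm, sub_add_cancel, (extChartAt 𝓘(ℝ, F) x).left_inv hy]

lemma centeredSymm_localRep {v : F} (hv : v ∈ localDomain F x g) :
    centeredSymm x (localRep F x g v) = g (centeredSymm x v) := centeredSymm_centered hv.2

lemma localRep_centered {y : M} (hy : y ∈ (extChartAt 𝓘(ℝ, F) x).source) :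
    localRep F x g (centered x y) = centered x (g y) := by
  rw [localRep, centeredSymm_centered hy]

lemma contMDiff_iterate {r : ℕ∞} {g : M → M} (hg : ContMDiff 𝓘(ℝ, F) 𝓘(ℝ, F) r g) (n : ℕ) :
    ContMDiff 𝓘(ℝ, F) 𝓘(ℝ, F) r g^[n] := by
  induction n with
  | zero => exact contMDiff_id
  | succ n ih => rw [Function.iterate_succ']; exact hg.comp ih

variable {r : ℕ∞} [IsManifold 𝓘(ℝ, F) r M]

lemma contMDiffOn_centeredSymm :
    ContMDiffOn 𝓘(ℝ, F) 𝓘(ℝ, F) r (centeredSymm x) (centeredTarget F x) := by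
  have h : ContMDiff 𝓘(ℝ, F) 𝓘(ℝ, F) r (fun v : F => v + extChartAt 𝓘(ℝ, F) x x) := by
    rw [contMDiff_iff_contDiff]
    fun_prop
  exact (contMDiffOn_extChartAt_symm x).comp h.contMDiffOn fun v hv => hv

lemma contMDiffOn_centered :
    ContMDiffOn 𝓘(ℝ, F) 𝓘(ℝ, F) r (centered x : M → F) (extChartAt 𝓘(ℝ, F) x).source := by
  have h : ContMDiff 𝓘(ℝ, F) 𝓘(ℝ, F) r (fun v : F => v - extChartAt 𝓘(ℝ, F) x x) := by
    rw [contMDiff_iff_contDiff]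
    fun_prop
  rw [extChartAt_source]
  exact h.comp_contMDiffOn contMDiffOn_extChartAt

lemma isOpen_localDomain (hg : Continuous g) : IsOpen (localDomain F x g) := by
  have h : ContinuousOn (centeredSymm x) (centeredTarget F x) :=
    (continuousOn_extChartAt_symm x).comp (continuous_add_const _).continuousOn fun v hv => hv
  exact (hg.comp_continuousOn h).isOpen_inter_preimage isOpen_centeredTarget
    (isOpen_extChartAt_source x)

lemma zero_mem_localDomain (hx : g x = x) : (0 : F) ∈ localDomain F x g := by
  refine ⟨zero_mem_centeredTarget, ?_⟩
  rw [mem_preimage, centeredSymm_zero, hx]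
  exact mem_extChartAt_source x

lemma localRep_zero (hx : g x = x) : localRep F x g 0 = 0 := by
  rw [localRep, centeredSymm_zero, hx, centered_self]

lemma contDiffOn_localRep (hg : ContMDiff 𝓘(ℝ, F) 𝓘(ℝ, F) r g) :
    ContDiffOn ℝ r (localRep F x g) (localDomain F x g) := by
  rw [← contMDiffOn_iff_contDiffOn]
  exact contMDiffOn_centered.comp (hg.comp_contMDiffOn
    (contMDiffOn_centeredSymm.mono inter_subset_left)) fun v hv => hv.2

lemma fderiv_localRep_zero (hg : MDifferentiableAt 𝓘(ℝ, F) 𝓘(ℝ, F) g x) (hx : g x = x) :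
    fderiv ℝ (localRep F x g) 0 = (mfderiv 𝓘(ℝ, F) 𝓘(ℝ, F) g x : F →L[ℝ] F) := by
  have h1 : localRep F x g = fun v => writtenInExtChartAt 𝓘(ℝ, F) 𝓘(ℝ, F) x g
      (v + extChartAt 𝓘(ℝ, F) x x) - extChartAt 𝓘(ℝ, F) x x := by
    ext v
    rw [writtenInExtChartAt, hx]
    rfl
  rw [h1, fderiv_sub_const, fderiv_comp_add_right, zero_add, hg.mfderiv]
  simp only [ModelWithCorners.range_eq_univ, fderivWithin_univ]

end CenteredChart

/-! ### Points of the stable set and small rescaled orbits. -/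

section StableSet

open Manifold
open scoped NNReal ENNReal

universe u
variable {F : Type*} [NormedAddCommGroup F] [NormedSpace ℝ F]
  {M : Type u} [TopologicalSpace M] [ChartedSpace F M]

/-- Points of small rescaled orbits of the local representation. -/
lemma iterate_centeredSymm {x : M} {g : M → M} {b : ℝ} {ζ : C₀(ℕ, F)}
    (hζ : IsRescaledOrbit b (localRep F x g) ζ) (hdom : ∀ n, b ^ n • ζ n ∈ localDomain F x g)
    (n : ℕ) : g^[n] (centeredSymm x (ζ 0)) = centeredSymm x (b ^ n • ζ n) := by
  induction n with
  | zero => simp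
  | succ n ih =>
    rw [Function.iterate_succ_apply', ih, hζ n, centeredSymm_localRep (hdom n)]

variable [Bundle.RiemannianBundle (fun x : M => TangentSpace 𝓘(ℝ, F) x)]

variable (F) in
/-- The points whose forward orbit approaches `x` faster than `bⁿ`. -/
def fastStableSet (g : M → M) (x : M) (b : ℝ) : Set M :=
  {y | Tendsto (fun n : ℕ => ENNReal.ofReal (1 / b ^ n) *
    riemannianEDist 𝓘(ℝ, F) x (g^[n] y)) atTop (𝓝 0)}

/-- Moving one step along the orbit changes the weighted distances by a shift of the index and the
constant factor `b`. -/
lemma mem_fastStableSet_apply_iff {g : M → M} {x y : M} {b : ℝ} (hb : 0 < b) :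
    g y ∈ fastStableSet F g x b ↔ y ∈ fastStableSet F g x b := by
  simp only [fastStableSet, mem_ofPred_eq]
  rw [← tendsto_add_atTop_iff_nat (f := fun n : ℕ => ENNReal.ofReal (1 / b ^ n) *
    riemannianEDist 𝓘(ℝ, F) x (g^[n] y)) 1]
  simp only [← Function.iterate_succ_apply]
  constructor
  · intro h
    have := ENNReal.Tendsto.const_mul (a := ENNReal.ofReal (1 / b)) h (Or.inr ENNReal.ofReal_ne_top)
    rw [mul_zero] at this
    refine this.congr fun n => ?_
    rw [← mul_assoc, ← ENNReal.ofReal_mul (by positivity)]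
    congr 2
    rw [pow_succ]
    field_simp
  · intro h
    have := ENNReal.Tendsto.const_mul (a := ENNReal.ofReal b) h (Or.inr ENNReal.ofReal_ne_top)
    rw [mul_zero] at this
    refine this.congr fun n => ?_
    rw [← mul_assoc, ← ENNReal.ofReal_mul (by positivity)]
    congr 2
    rw [pow_succ]
    field_simp

lemma mem_fastStableSet_iterate_iff {g : M → M} {x y : M} {b : ℝ} (hb : 0 < b) (n : ℕ) :
    g^[n] y ∈ fastStableSet F g x b ↔ y ∈ fastStableSet F g x b := by
  induction n with
  | zero => rfl
  | succ n ih => rw [Function.iterate_succ_apply', mem_fastStableSet_apply_iff hb, ih]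

variable [IsManifold 𝓘(ℝ, F) 1 M]
  [IsContinuousRiemannianBundle F (fun x : M => TangentSpace 𝓘(ℝ, F) x)]

/-- Near `x` the Riemannian distance is at most a constant times the chart distance, here `b^n ‖ζ
n‖`; division by `b^n` leaves a null sequence. -/
lemma centeredSymm_mem_fastStableSet {x : M} {g : M → M} {b : ℝ} (hb0 : 0 < b) (hb1 : b < 1)
    {ζ : C₀(ℕ, F)} (hζ : IsRescaledOrbit b (localRep F x g) ζ)
    (hdom : ∀ n, b ^ n • ζ n ∈ localDomain F x g) :
    centeredSymm x (ζ 0) ∈ fastStableSet F g x b := by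
  obtain ⟨C, -, hC⟩ := eventually_riemannianEDist_le_edist_extChartAt 𝓘(ℝ, F) x
  have hz : Tendsto (fun n => b ^ n • ζ n) atTop (𝓝 0) := by
    have := (tendsto_pow_atTop_nhds_zero_of_lt_one hb0.le hb1).smul (tendsto_nullSeq ζ)
    rwa [zero_smul] at this
  have hψ : ContinuousAt (centeredSymm x : F → M) 0 :=
    (contMDiffOn_centeredSymm (r := 1)).continuousOn.continuousAt
      (isOpen_centeredTarget.mem_nhds zero_mem_centeredTarget)
  have hev := (hψ.tendsto.comp hz)
  rw [centeredSymm_zero] at hev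
  have hn : Tendsto (fun n => (C : ℝ≥0∞) * ‖ζ n‖ₑ) atTop (𝓝 0) := by
    have := ENNReal.Tendsto.const_mul (a := (C : ℝ≥0∞)) (tendsto_nullSeq ζ).enorm
      (Or.inr ENNReal.coe_ne_top)
    simpa using this
  refine tendsto_of_tendsto_of_tendsto_of_le_of_le' tendsto_const_nhds hn
    (Eventually.of_forall fun _ => zero_le) ?_
  filter_upwards [hev.eventually hC] with n hn
  rw [iterate_centeredSymm hζ hdom]
  refine (mul_le_mul_right hn _).trans (le_of_eq ?_)
  have h1 : edist (extChartAt 𝓘(ℝ, F) x x) (extChartAt 𝓘(ℝ, F) x (centeredSymm x (b ^ n • ζ n)))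
      = ENNReal.ofReal (b ^ n) * ‖ζ n‖ₑ := by
    have h2 : extChartAt 𝓘(ℝ, F) x (centeredSymm x (b ^ n • ζ n)) - extChartAt 𝓘(ℝ, F) x x
      = b ^ n • ζ n := centered_centeredSymm (hdom n).1
    rw [edist_comm, edist_eq_enorm_sub, h2, enorm_smul, Real.enorm_of_nonneg (by positivity)]
  simp only [Function.comp_apply]
  rw [h1, mul_left_comm, ← mul_assoc (ENNReal.ofReal _), ← ENNReal.ofReal_mul (by positivity)]
  rw [one_div, inv_mul_cancel₀ (by positivity), ENNReal.ofReal_one, one_mul]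

/-- This is the converse, from the opposite comparison of distances. Discarding enough initial
points puts the orbit inside the chart and makes the rescaled sequence smaller than any given `δ`.
-/
lemma exists_rescaledOrbit_of_mem_fastStableSet [RegularSpace M] {x y : M} {g : M → M} {b : ℝ}
    (hb0 : 0 < b) (hb1 : b < 1) (hy : y ∈ fastStableSet F g x b) {δ : ℝ} (hδ : 0 < δ) :
    ∃ (m : ℕ) (ζ : C₀(ℕ, F)), ‖ζ‖ < δ ∧ IsRescaledOrbit b (localRep F x g) ζ ∧
      centeredSymm x (ζ 0) = g^[m] y := by
  obtain ⟨C, c, hc, hC⟩ := exists_edist_extChartAt_le_riemannianEDist (F := F) x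
  have hbn : ∀ n : ℕ, 1 ≤ ENNReal.ofReal (1 / b ^ n) := fun n => by
    rw [ENNReal.one_le_ofReal]
    exact (one_le_div (by positivity)).2 (pow_le_one₀ hb0.le hb1.le)
  have hev : ∀ᶠ n in atTop, riemannianEDist 𝓘(ℝ, F) x (g^[n] y) < c := by
    have h1 := (tendsto_order.1 hy).2 (c : ℝ≥0∞) (by exact_mod_cast hc)
    filter_upwards [h1] with n hn
    refine lt_of_le_of_lt ?_ hn
    calc riemannianEDist 𝓘(ℝ, F) x (g^[n] y) = 1 * riemannianEDist 𝓘(ℝ, F) x (g^[n] y) :=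
          (one_mul _).symm
      _ ≤ _ := mul_le_mul_left (hbn n) _
  let w : ℕ → F := fun n => (b ^ n)⁻¹ • centered x (g^[n] y)
  have hw : Tendsto w atTop (𝓝 0) := by
    rw [tendsto_zero_iff_enorm_tendsto_zero]
    have h2 : Tendsto (fun n => (C : ℝ≥0∞) * (ENNReal.ofReal (1 / b ^ n) *
        riemannianEDist 𝓘(ℝ, F) x (g^[n] y))) atTop (𝓝 0) := by
      have := ENNReal.Tendsto.const_mul (a := (C : ℝ≥0∞)) hy (Or.inr ENNReal.coe_ne_top)
      rwa [mul_zero] at this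
    refine tendsto_of_tendsto_of_tendsto_of_le_of_le' tendsto_const_nhds h2
      (Eventually.of_forall fun _ => zero_le) ?_
    filter_upwards [hev] with n hn
    have h3 := (hC _ hn).2
    rw [edist_comm, edist_eq_enorm_sub] at h3
    simp only [w]
    rw [enorm_smul, Real.enorm_of_nonneg (by positivity), mul_left_comm, one_div]
    exact mul_le_mul_right h3 _
  obtain ⟨m, hm⟩ := eventually_atTop.1 (hev.and
    ((tendsto_zero_iff_norm_tendsto_zero.1 hw).eventually (gt_mem_nhds (half_pos hδ))))
  -- The factor `b ^ m` restores the normalization: after it, `b ^ n` times the `n`-th term is the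
  -- chart coordinate of `g^[n + m] y`.
  have hshift : Tendsto (fun n => b ^ m • w (n + m)) atTop (𝓝 0) := by
    have := (hw.comp (tendsto_add_atTop_nat m)).const_smul (b ^ m)
    rwa [smul_zero] at this
  have hval : ∀ n, b ^ n • nullSeq _ hshift n = centered x (g^[n + m] y) := fun n => by
    rw [nullSeq_apply, smul_smul, ← pow_add]
    exact smul_inv_smul₀ (by positivity) _
  have hsrc : ∀ n, g^[n + m] y ∈ (extChartAt 𝓘(ℝ, F) x).source := fun n =>
    (hC _ (hm (n + m) (Nat.le_add_left _ _)).1).1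
  refine ⟨m, nullSeq _ hshift, ?_, ?_, ?_⟩
  · refine lt_of_le_of_lt ((norm_nullSeq_le (half_pos hδ).le).2 fun n => ?_) (half_lt_self hδ)
    rw [nullSeq_apply, norm_smul, norm_pow, Real.norm_of_nonneg hb0.le]
    exact (mul_le_of_le_one_left (norm_nonneg _) (pow_le_one₀ hb0.le hb1.le)).trans
      (hm (n + m) (Nat.le_add_left _ _)).2.le
  · intro n
    rw [hval, hval, localRep_centered (hsrc n), ← Function.iterate_succ_apply' g]
    congr 3
    omega
  · have h0 := hval 0
    rw [pow_zero, one_smul] at h0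
    rw [h0, centeredSymm_centered (hsrc 0), zero_add]

end StableSet

end ConformallySymplectic

end

noncomputable section

namespace ConformallySymplectic

open scoped BoundedContinuousFunction ZeroAtInfty
open Filter Set Metric

/-! ### The global stable set as an immersed manifold. -/

section Parametrization

set_option synthInstance.maxHeartbeats 200000

universe u v
variable {F : Type v} [NormedAddCommGroup F] [NormedSpace ℝ F]

/-- This is the action of `g` on orbits: the first point is dropped and the weights are
renormalized. For `0 < b ≤ 1` the norm does not increase, so the local piece is mapped into itself.
-/
lemma isRescaledOrbit_smul_shift {b : ℝ} {g : F → F} {ζ : C₀(ℕ, F)} (hζ : IsRescaledOrbit b g ζ) :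
    IsRescaledOrbit b g (b • shiftNull ℝ F ζ) := by
  intro n
  have := hζ (n + 1)
  rw [ZeroAtInftyContinuousMap.smul_apply, ZeroAtInftyContinuousMap.smul_apply, shiftNull_apply,
    shiftNull_apply, smul_smul, smul_smul, ← pow_succ, ← pow_succ]
  exact this

lemma IsRescaledOrbit.ext {b : ℝ} (hb : 0 < b) {g : F → F} {ζ ξ : C₀(ℕ, F)}
    (hζ : IsRescaledOrbit b g ζ) (hξ : IsRescaledOrbit b g ξ) (h0 : ζ 0 = ξ 0) : ζ = ξ := by
  ext n
  induction n with
  | zero => exact h0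
  | succ n ih =>
    have h1 := hζ n
    rw [ih, ← hξ n] at h1
    exact smul_right_injective F (pow_ne_zero (n + 1) hb.ne') h1

/-- A tangent vector to a family of rescaled orbits is determined by its initial entry. -/
lemma deriv_rescaledOrbit_eq_zero {b : ℝ} (hb : 0 < b) {g : F → F} {U : Set F} (hU : IsOpen U)
    (hg : ContDiffOn ℝ 1 g U) {E : Type*} [NormedAddCommGroup E] [NormedSpace ℝ E]
    {σ : E → C₀(ℕ, F)} {V : Set E} (hV : IsOpen V)
    (horb : ∀ v ∈ V, IsRescaledOrbit b g (σ v)) {v : E} (hv : v ∈ V)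
    (hdom : ∀ n, b ^ n • σ v n ∈ U) (hσ : DifferentiableAt ℝ σ v) {u : E}
    (h0 : fderiv ℝ σ v u 0 = 0) : fderiv ℝ σ v u = 0 := by
  have hev : ∀ n, HasFDerivAt (fun w => b ^ n • σ w n)
      (b ^ n • (evalNull F n).comp (fderiv ℝ σ v)) v := fun n =>
    ((evalNull F n).hasFDerivAt.comp v hσ.hasFDerivAt).const_smul (b ^ n)
  ext n
  induction n with
  | zero => exact h0
  | succ n ih =>
    have h1 := hev (n + 1)
    have hgd : HasFDerivAt g (fderiv ℝ g (b ^ n • σ v n)) (b ^ n • σ v n) :=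
      ((hg.contDiffAt (hU.mem_nhds (hdom n))).differentiableAt one_ne_zero).hasFDerivAt
    have h2 : HasFDerivAt (fun w => b ^ (n + 1) • σ w (n + 1))
        ((fderiv ℝ g (b ^ n • σ v n)).comp (b ^ n • (evalNull F n).comp (fderiv ℝ σ v))) v := by
      refine (hgd.comp v (hev n)).congr_of_eventuallyEq ?_
      filter_upwards [hV.mem_nhds hv] with w hw using horb w hw n
    have h3 := DFunLike.congr_fun (h1.unique h2) u
    simp only [smul_apply, ContinuousLinearMap.comp_apply, evalNull_apply] at h3
    rw [ih, ZeroAtInftyContinuousMap.zero_apply, smul_zero, map_zero] at h3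
    exact (smul_eq_zero.1 h3).resolve_left (pow_ne_zero _ hb.ne')

variable [FiniteDimensional ℝ F]
  {M : Type u} [TopologicalSpace M] [ChartedSpace F M] [IsManifold 𝓘(ℝ, F) 1 M]
  [Bundle.RiemannianBundle (fun x : M => TangentSpace 𝓘(ℝ, F) x)]
  [IsContinuousRiemannianBundle F (fun x : M => TangentSpace 𝓘(ℝ, F) x)]

/-- The stable set of a fixed point without multipliers of modulus `b` is an injectively immersed
manifold, and vectors tangent to it contract faster than `bⁿ`. -/
theorem exists_immersion_fastStableSet [T2Space M] {r : ℕ∞} (hr : 1 ≤ r) [IsManifold 𝓘(ℝ, F) r M]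
    {g g' : M → M} (hg : ContMDiff 𝓘(ℝ, F) 𝓘(ℝ, F) r g) (hg' : ContMDiff 𝓘(ℝ, F) 𝓘(ℝ, F) r g')
    (hl : Function.LeftInverse g' g) (hri : Function.RightInverse g' g) {x : M} (hx : g x = x)
    {b : ℝ} (hb0 : 0 < b) (hb1 : b < 1)
    (A : F →L[ℝ] F) (hA : A = mfderiv 𝓘(ℝ, F) 𝓘(ℝ, F) g x)
    (hT : ∀ z, (((b⁻¹ • A : F →L[ℝ] F) : F →ₗ[ℝ] F).charpoly.map (algebraMap ℝ ℂ)).IsRoot z →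
      ‖z‖ ≠ 1) :
    ∃ (k : ℕ) (N : Type u) (_ : TopologicalSpace N)
      (_ : ChartedSpace (EuclideanSpace ℝ (Fin k)) N) (ι : N → M),
      T2Space N ∧ SecondCountableTopology N ∧ IsManifold (𝓡 k) r N ∧
      Manifold.IsImmersion (𝓡 k) 𝓘(ℝ, F) r ι ∧ Function.Injective ι ∧
      range ι = fastStableSet F g x b ∧
      ∀ p : N, ∃ (n : ℕ) (z : ℕ → F) (L : ℕ → TangentSpace (𝓡 k) p →L[ℝ] F),
        Tendsto z atTop (𝓝 0) ∧ (∀ u, Tendsto (fun j => L j u) atTop (𝓝 0)) ∧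
        (∀ j, z j ∈ centeredTarget F x) ∧
        ∀ j, g^[j + n] (ι p) = centeredSymm x (z j) ∧
          ∀ u, (mfderiv 𝓘(ℝ, F) 𝓘(ℝ, F) g^[j + n] (ι p) (mfderiv (𝓡 k) 𝓘(ℝ, F) ι p u) : F) =
            b ^ j • (mfderiv 𝓘(ℝ, F) 𝓘(ℝ, F) (centeredSymm x) (z j) (L j u) : F) := by
  have hr0 : (r : ℕ∞ω) ≠ 0 := by
    have : r ≠ 0 := (zero_lt_one.trans_le hr).ne'
    exact_mod_cast this
  have : LocallyCompactSpace M := Manifold.locallyCompact_of_finiteDimensional 𝓘(ℝ, F)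
  have hU := isOpen_localDomain (F := F) (x := x) hg.continuous
  have hloc : ContDiffOn ℝ r (localRep F x g) (localDomain F x g) := contDiffOn_localRep hg
  have hloc1 : ContDiffOn ℝ 1 (localRep F x g) (localDomain F x g) :=
    hloc.of_le (by exact_mod_cast hr)
  obtain ⟨ρ, hρ0, hρ⟩ := Metric.nhds_basis_closedBall.mem_iff.1
    (hU.mem_nhds (zero_mem_localDomain hx))
  rw [hA.trans (fderiv_localRep_zero (hg.mdifferentiableAt hr0) hx).symm] at hT
  obtain ⟨k, V, σ, P, δ, hδ, hδρ, hV, hσ, hσorb, hσP, hPσ⟩ := exists_chart_null_orbits hb0 hb1.le hU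
    hr hloc (localRep_zero hx) hρ0 hρ hT
  have hdom : ∀ ζ : C₀(ℕ, F), ‖ζ‖ < δ → ∀ n, b ^ n • ζ n ∈ localDomain F x g := fun ζ hζ n =>
    hρ (weight_smul_mem hb0 hb1.le (hζ.le.trans hδρ) n)
  -- The `n`-th piece is the preimage of the local stable manifold under `g^[n]`, and `τ` below is
  -- `g` read in the parameters.
  let q : ℕ → EuclideanSpace ℝ (Fin k) → M := fun n v => g'^[n] (centeredSymm x (σ v 0))
  let τ : EuclideanSpace ℝ (Fin k) → EuclideanSpace ℝ (Fin k) := fun v =>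
    P (b • shiftNull ℝ F (σ v))
  have hgn := contMDiff_iterate hg
  have hgn' := contMDiff_iterate hg'
  have hgq : ∀ n j, ∀ v ∈ V, g^[j + n] (q n v) = centeredSymm x (b ^ j • σ v j) := by
    intro n j v hv
    rw [Function.iterate_add_apply, (hri.iterate n), iterate_centeredSymm (hσorb v hv).2
      (hdom _ (hσorb v hv).1)]
  have hτ : ∀ v ∈ V, τ v ∈ V ∧ σ (τ v) = b • shiftNull ℝ F (σ v) := by
    intro v hv
    refine hσP _ ?_ (isRescaledOrbit_smul_shift (hσorb v hv).2)
    refine lt_of_le_of_lt ?_ (hσorb v hv).1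
    rw [norm_smul, Real.norm_of_nonneg hb0.le]
    refine (mul_le_of_le_one_left (norm_nonneg _) hb1.le).trans ?_
    simpa using (shiftNull ℝ F).le_of_opNorm_le norm_shiftNull_le (σ v)
  have hσd : ∀ v ∈ V, DifferentiableAt ℝ σ v := fun v hv =>
    (hσ.contDiffAt (hV.mem_nhds hv)).differentiableAt hr0
  have hzd : ∀ v ∈ V, ∀ j, HasFDerivAt (fun w => b ^ j • σ w j)
      (b ^ j • (evalNull F j).comp (fderiv ℝ σ v)) v := fun v hv j =>
    ((evalNull F j).hasFDerivAt.comp v (hσd v hv).hasFDerivAt).const_smul (b ^ j)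
  have hqs : ∀ n, ContMDiffOn (𝓡 k) 𝓘(ℝ, F) r (q n) V := by
    intro n
    have h1 : ContMDiffOn (𝓡 k) 𝓘(ℝ, F) r (fun v => σ v 0) V := by
      rw [contMDiffOn_iff_contDiffOn]
      exact (evalNull F 0).contDiff.comp_contDiffOn hσ
    refine (hgn' n).comp_contMDiffOn (contMDiffOn_centeredSymm.comp h1 fun v hv => ?_)
    have := (hdom _ (hσorb v hv).1 0).1
    rwa [pow_zero, one_smul] at this
  have hqmd : ∀ n, ∀ v ∈ V, MDifferentiableAt (𝓡 k) 𝓘(ℝ, F) (q n) v := fun n v hv =>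
    ((hqs n).contMDiffAt (hV.mem_nhds hv)).mdifferentiableAt hr0
  have hmf : ∀ n j, ∀ v ∈ V, ∀ u : EuclideanSpace ℝ (Fin k),
      (mfderiv 𝓘(ℝ, F) 𝓘(ℝ, F) g^[j + n] (q n v) (mfderiv (𝓡 k) 𝓘(ℝ, F) (q n) v u) : F) =
        b ^ j • (mfderiv 𝓘(ℝ, F) 𝓘(ℝ, F) (centeredSymm x) (b ^ j • σ v j)
          (fderiv ℝ σ v u j) : F) := by
    intro n j v hv u
    have h1 : g^[j + n] ∘ q n =ᶠ[𝓝 v] centeredSymm x ∘ fun w => b ^ j • σ w j := by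
      filter_upwards [hV.mem_nhds hv] with w hw using hgq n j w hw
    have h2 : mfderiv (𝓡 k) 𝓘(ℝ, F) (g^[j + n] ∘ q n) v = _ :=
      mfderiv_comp v ((hgn (j + n)).mdifferentiableAt hr0) (hqmd n v hv)
    have hmem : b ^ j • σ v j ∈ centeredTarget F x := (hdom _ (hσorb v hv).1 j).1
    have h3 : mfderiv (𝓡 k) 𝓘(ℝ, F) (centeredSymm x ∘ fun w => b ^ j • σ w j) v = _ :=
      mfderiv_comp v (((contMDiffOn_centeredSymm (r := r)).contMDiffAt
        (isOpen_centeredTarget.mem_nhds hmem)).mdifferentiableAt hr0)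
        (hzd v hv j).differentiableAt.mdifferentiableAt
    have h4 := h1.mfderiv_eq (I := 𝓡 k) (I' := 𝓘(ℝ, F))
    rw [h2, h3, mfderiv_eq_fderiv, (hzd v hv j).fderiv] at h4
    have h5 := DFunLike.congr_fun h4 u
    refine h5.trans ?_
    exact map_smul (mfderiv 𝓘(ℝ, F) 𝓘(ℝ, F) (centeredSymm x) (b ^ j • σ v j)) (b ^ j)
      (fderiv ℝ σ v u j)
  have hmfinj : ∀ z ∈ centeredTarget F x,
      Function.Injective (mfderiv 𝓘(ℝ, F) 𝓘(ℝ, F) (centeredSymm x) z) := by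
    intro z hz
    have h1 : centered x ∘ centeredSymm x =ᶠ[𝓝 z] id := by
      filter_upwards [isOpen_centeredTarget.mem_nhds hz] with w hw using centered_centeredSymm hw
    have h2 : mfderiv 𝓘(ℝ, F) 𝓘(ℝ, F) (centered x ∘ centeredSymm x) z = _ := mfderiv_comp z
      (((contMDiffOn_centered (r := r)).contMDiffAt ((isOpen_extChartAt_source x).mem_nhds
        (centeredSymm_mem_source hz))).mdifferentiableAt hr0)
      (((contMDiffOn_centeredSymm (r := r)).contMDiffAt
        (isOpen_centeredTarget.mem_nhds hz)).mdifferentiableAt hr0)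
    have h3 := h1.mfderiv_eq (I := 𝓘(ℝ, F)) (I' := 𝓘(ℝ, F))
    rw [h2, mfderiv_id] at h3
    intro a c hac
    have ha := DFunLike.congr_fun h3 a
    have hc := DFunLike.congr_fun h3 c
    refine ha.symm.trans (Eq.trans ?_ hc)
    exact congrArg (mfderiv 𝓘(ℝ, F) 𝓘(ℝ, F) (centered x) (centeredSymm x z)) hac
  have hqd : ∀ n, ∀ v ∈ V, Function.Injective (mfderiv (𝓡 k) 𝓘(ℝ, F) (q n) v) := by
    intro n v hv
    rw [injective_iff_map_eq_zero]
    intro u hu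
    have h1 := hmf n 0 v hv u
    rw [hu, map_zero, pow_zero, one_smul, one_smul] at h1
    have hmem : σ v 0 ∈ centeredTarget F x := by
      have := (hdom _ (hσorb v hv).1 0).1
      rwa [pow_zero, one_smul] at this
    have h2 : fderiv ℝ σ v u 0 = 0 := hmfinj _ hmem (h1.symm.trans (map_zero _).symm)
    have h3 := deriv_rescaledOrbit_eq_zero hb0 hU hloc1 hV (fun w hw => (hσorb w hw).2) hv
      (hdom _ (hσorb v hv).1) (hσd v hv) h2
    -- Because `P ∘ σ` is the identity on `V`, a parameter vector along which `σ` has zero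
    -- derivative is itself zero.
    have h4 : HasFDerivAt (fun w => w) (P.comp (fderiv ℝ σ v)) v := by
      refine (P.hasFDerivAt.comp v (hσd v hv).hasFDerivAt).congr_of_eventuallyEq ?_
      filter_upwards [hV.mem_nhds hv] with w hw using (hPσ w hw).symm
    have h5 := DFunLike.congr_fun (h4.unique (hasFDerivAt_id v)) u
    refine h5.symm.trans ?_
    exact (congrArg P h3).trans (map_zero P)
  have hqinj : ∀ n, InjOn (q n) V := by
    intro n v hv w hw hvw
    have h1 := (hri.injective.iterate n) hvw
    have hmem : ∀ v ∈ V, σ v 0 ∈ centeredTarget F x := fun v hv => by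
      have := (hdom _ (hσorb v hv).1 0).1
      rwa [pow_zero, one_smul] at this
    have h2 : σ v 0 = σ w 0 := by
      rw [← centered_centeredSymm (hmem v hv), h1, centered_centeredSymm (hmem w hw)]
    rw [← hPσ v hv, ← hPσ w hw, IsRescaledOrbit.ext hb0 (hσorb v hv).2 (hσorb w hw).2 h2]
  have hVne : V.Nonempty := by
    refine ⟨P 0, (hσP 0 (by simpa using hδ) fun n => ?_).1⟩
    simp [localRep_zero hx]
  have hτs : ContDiffOn ℝ r τ V :=
    P.contDiff.comp_contDiffOn
      (((shiftNull ℝ F).contDiff.comp_contDiffOn hσ).const_smul b)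
  have hqτ : ∀ n, ∀ v ∈ V, q n v = q (n + 1) (τ v) := by
    intro n v hv
    have h1 := iterate_centeredSymm (hσorb v hv).2 (hdom _ (hσorb v hv).1) 1
    have h2 : σ (τ v) 0 = b ^ 1 • σ v 1 := by
      rw [(hτ v hv).2, pow_one]; rfl
    change _ = g'^[n + 1] (centeredSymm x (σ (τ v) 0))
    rw [h2, ← h1, Function.iterate_succ_apply]
    change _ = g'^[n] (g' (g _))
    rw [hl]
  obtain ⟨N, tN, cN, ι, hT2, hsc, hman, himm, hinj, hran, hp⟩ :=
    exists_immersed_union hr hV hVne hqinj hqs hqd hτs (fun v hv => (hτ v hv).1) hqτ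
  refine ⟨k, N, tN, cN, ι, hT2, hsc, hman, himm, hinj, ?_, fun p => ?_⟩
  · rw [hran]
    ext y
    rw [mem_iUnion]
    constructor
    · rintro ⟨n, v, hv, rfl⟩
      rw [← mem_fastStableSet_iterate_iff hb0 n, hri.iterate n]
      exact centeredSymm_mem_fastStableSet hb0 hb1 (hσorb v hv).2 (hdom _ (hσorb v hv).1)
    · intro hy
      obtain ⟨m, ζ, hζδ, hζ, hζy⟩ := exists_rescaledOrbit_of_mem_fastStableSet hb0 hb1 hy hδ
      obtain ⟨hPV, hσζ⟩ := hσP ζ hζδ hζ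
      refine ⟨m, P ζ, hPV, ?_⟩
      change g'^[m] (centeredSymm x (σ (P ζ) 0)) = y
      rw [hσζ, hζy, hl.iterate m]
  · obtain ⟨n, e, hev, hed, heq⟩ := hp p
    have hι : ι p = q n (e p) := heq.eq_of_nhds
    have h1 := heq.mfderiv_eq (I := 𝓡 k) (I' := 𝓘(ℝ, F))
    rw [mfderiv_comp p (hqmd n _ hev) hed] at h1
    refine ⟨n, fun j => b ^ j • σ (e p) j,
      fun j => (evalNull F j).comp ((fderiv ℝ σ (e p)).comp
        (mfderiv (𝓡 k) (𝓡 k) e p : TangentSpace (𝓡 k) p →L[ℝ] EuclideanSpace ℝ (Fin k))),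
      ?_, fun u => tendsto_nullSeq _, fun j => (hdom _ (hσorb _ hev).1 j).1, fun j => ⟨?_, ?_⟩⟩
    · have := (tendsto_pow_atTop_nhds_zero_of_lt_one hb0.le hb1).smul (tendsto_nullSeq (σ (e p)))
      rwa [zero_smul] at this
    · rw [hι, hgq n j _ hev]
    · intro u
      rw [h1, hι]
      exact hmf n j _ hev _

end Parametrization

end ConformallySymplectic

end

noncomputable section

namespace ConformallySymplectic


/-! ### Eigenvalues under scaling and inversion. -/

section Spectrum

variable {F : Type*} [NormedAddCommGroup F] [NormedSpace ℝ F]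

lemma mem_spectrum_baseChange_of_isRoot_charpoly [FiniteDimensional ℝ F] {T : F →ₗ[ℝ] F}
    {b : ℝ} (hb : b ≠ 0) {z : ℂ}
    (hz : ((b⁻¹ • T).charpoly.map (algebraMap ℝ ℂ)).IsRoot z) :
    (b : ℂ) * z ∈ spectrum ℂ (T.baseChange ℂ : Module.End ℂ (ℂ ⊗[ℝ] F)) := by
  rw [← LinearMap.charpoly_baseChange, ← Module.End.mem_spectrum_iff_isRoot_charpoly] at hz
  have h := (spectrum.smul_mem_smul_iff (r := Units.mk0 (b : ℂ) (by exact_mod_cast hb))).2 hz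
  have h2 : Units.mk0 (b : ℂ) (by exact_mod_cast hb) • ((b⁻¹ • T).baseChange ℂ :
      Module.End ℂ (ℂ ⊗[ℝ] F)) = T.baseChange ℂ := by
    rw [Units.smul_mk0, LinearMap.baseChange_smul, ← Complex.coe_algebraMap, algebraMap_smul,
      smul_smul, mul_inv_cancel₀ hb, one_smul]
  rw [h2] at h
  exact h

lemma inv_mem_spectrum_baseChange {S T : F →ₗ[ℝ] F} (h₁ : S ∘ₗ T = LinearMap.id)
    (h₂ : T ∘ₗ S = LinearMap.id) {z : ℂ} (hz0 : z ≠ 0)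
    (hz : z ∈ spectrum ℂ (S.baseChange ℂ : Module.End ℂ (ℂ ⊗[ℝ] F))) :
    z⁻¹ ∈ spectrum ℂ (T.baseChange ℂ : Module.End ℂ (ℂ ⊗[ℝ] F)) := by
  let U : (Module.End ℂ (ℂ ⊗[ℝ] F))ˣ := ⟨S.baseChange ℂ, T.baseChange ℂ,
    by rw [← LinearMap.baseChange_mul, Module.End.mul_eq_comp, h₁, LinearMap.baseChange_id]; rfl,
    by rw [← LinearMap.baseChange_mul, Module.End.mul_eq_comp, h₂, LinearMap.baseChange_id]; rfl⟩
  exact (spectrum.inv_mem_iff (r := Units.mk0 z hz0) (a := U)).1 hz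

end Spectrum

/-! ### Conformal maps and vanishing of the form on contracted vectors. -/

section Conformal

open Filter

universe u
variable {d : ℕ} {M : Type u} [TopologicalSpace M] [ChartedSpace (EuclideanSpace ℝ (Fin (2 * d))) M]
  {Ω : SymplecticForm d M}

lemma IsConformal.comp {g h : M → M} {A B : ℝ} (hg : IsConformal Ω g A) (hh : IsConformal Ω h B)
    (hgd : MDifferentiable (𝓡 (2 * d)) (𝓡 (2 * d)) g)
    (hhd : MDifferentiable (𝓡 (2 * d)) (𝓡 (2 * d)) h) : IsConformal Ω (g ∘ h) (A * B) := by
  intro x u v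
  rw [mfderiv_comp x (hgd _) (hhd x)]
  refine (hg (h x) _ _).trans ?_
  exact (congrArg (A * ·) (hh x u v)).trans (mul_assoc _ _ _).symm

lemma isConformal_id : IsConformal Ω id 1 := by
  intro x u v
  rw [mfderiv_id, one_mul]
  rfl

lemma IsConformal.iterate {g : M → M} {A : ℝ} (hg : IsConformal Ω g A)
    (hgd : MDifferentiable (𝓡 (2 * d)) (𝓡 (2 * d)) g) (n : ℕ) : IsConformal Ω g^[n] (A ^ n) := by
  have h : IsConformal Ω g^[n] (A ^ n) ∧ MDifferentiable (𝓡 (2 * d)) (𝓡 (2 * d)) g^[n] := by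
    induction n with
    | zero => exact ⟨by simpa using isConformal_id, mdifferentiable_id⟩
    | succ n ih =>
      rw [Function.iterate_succ, pow_succ]
      exact ⟨ih.1.comp hg ih.2 hgd, ih.2.comp hgd⟩
  exact h.1

lemma IsConformal.of_rightInverse {g g' : M → M} {A : ℝ} (hA : A ≠ 0) (hg : IsConformal Ω g A)
    (hgd : MDifferentiable (𝓡 (2 * d)) (𝓡 (2 * d)) g)
    (hgd' : MDifferentiable (𝓡 (2 * d)) (𝓡 (2 * d)) g') (h : Function.RightInverse g' g) :
    IsConformal Ω g' A⁻¹ := by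
  intro x u v
  have h1 := hg (g' x) (mfderiv (𝓡 (2 * d)) (𝓡 (2 * d)) g' x u)
    (mfderiv (𝓡 (2 * d)) (𝓡 (2 * d)) g' x v)
  have h2 : Ω.form ((g ∘ g') x) ![mfderiv (𝓡 (2 * d)) (𝓡 (2 * d)) (g ∘ g') x u,
      mfderiv (𝓡 (2 * d)) (𝓡 (2 * d)) (g ∘ g') x v] = Ω.form x ![u, v] := by
    rw [h.comp_eq_id, mfderiv_id]
    rfl
  rw [mfderiv_comp x (hgd _) (hgd' x)] at h2
  have h3 := h1.symm.trans h2
  rw [← h3, inv_mul_cancel_left₀ hA]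

lemma continuousAt_chartForm (x : M) :
    ContinuousAt (chartForm Ω.form x) (extChartAt (𝓡 (2 * d)) x x) :=
  (Ω.smooth x).continuousOn.continuousAt (extChartAt_target_mem_nhds x)

/-- Evaluations of `Ω` at varying points near `x` become values of one continuous function on the
model space, so that limits can be taken. -/
lemma chartForm_apply_centered {x : M} {z : EuclideanSpace ℝ (Fin (2 * d))}
    (u v : EuclideanSpace ℝ (Fin (2 * d))) (hz : MDifferentiableAt
      𝓘(ℝ, EuclideanSpace ℝ (Fin (2 * d))) (𝓡 (2 * d)) (extChartAt (𝓡 (2 * d)) x).symm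
      (z + extChartAt (𝓡 (2 * d)) x x)) :
    Ω.form (centeredSymm x z) ![mfderiv (𝓡 (2 * d)) (𝓡 (2 * d)) (centeredSymm x) z u,
      mfderiv (𝓡 (2 * d)) (𝓡 (2 * d)) (centeredSymm x) z v] =
    chartForm Ω.form x (z + extChartAt (𝓡 (2 * d)) x x) ![u, v] := by
  have h1 : HasMFDerivAt 𝓘(ℝ, EuclideanSpace ℝ (Fin (2 * d))) 𝓘(ℝ, EuclideanSpace ℝ (Fin (2 * d)))
      (fun w => w + extChartAt (𝓡 (2 * d)) x x) z
      (ContinuousLinearMap.id ℝ (EuclideanSpace ℝ (Fin (2 * d)))) :=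
    ((hasFDerivAt_id z).add_const _).hasMFDerivAt
  have h2 := (hz.hasMFDerivAt.comp z h1).mfderiv
  have h3 : ∀ w : EuclideanSpace ℝ (Fin (2 * d)),
      (mfderiv (𝓡 (2 * d)) (𝓡 (2 * d)) (centeredSymm x) z w : EuclideanSpace ℝ (Fin (2 * d))) =
        mfderiv (𝓡 (2 * d)) (𝓡 (2 * d)) (extChartAt (𝓡 (2 * d)) x).symm
          (z + extChartAt (𝓡 (2 * d)) x x) w := fun w => DFunLike.congr_fun h2 w
  refine congrArg (Ω.form (centeredSymm x z)) (a₂ := fun i => mfderiv (𝓡 (2 * d)) (𝓡 (2 * d))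
    (extChartAt (𝓡 (2 * d)) x).symm (z + extChartAt (𝓡 (2 * d)) x x) (![u, v] i)) ?_
  funext i
  fin_cases i
  · exact h3 u
  · exact h3 v

lemma form_congr_smul {p q : M} (hpq : p = q) {c : ℝ} {u v : TangentSpace (𝓡 (2 * d)) p}
    {u' v' : TangentSpace (𝓡 (2 * d)) q}
    (hu : (u : EuclideanSpace ℝ (Fin (2 * d))) = c • (u' : EuclideanSpace ℝ (Fin (2 * d))))
    (hv : (v : EuclideanSpace ℝ (Fin (2 * d))) = c • (v' : EuclideanSpace ℝ (Fin (2 * d)))) :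
    Ω.form p ![u, v] = c ^ 2 * Ω.form q ![u', v'] := by
  subst hpq
  have h := (Ω.form p).toMultilinearMap.map_smul_univ (fun _ => c) ![u', v']
  rw [Fin.prod_univ_two, ← pow_two] at h
  refine Eq.trans (congrArg (Ω.form p) ?_) h
  funext i
  fin_cases i
  · exact hu
  · exact hv

/-- A conformal map with factor `A` shrinks `Ω` slower than `b ^ (2 * n)` when `b ^ 2 < A`, so
that `Ω` vanishes on vectors shrinking faster than `b ^ n`. -/
lemma form_eq_zero_of_contracted [IsManifold (𝓡 (2 * d)) 1 M] {g : M → M} {x y : M} {b A : ℝ}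
    (hb0 : 0 < b) (hbA : b ^ 2 < A)
    (hg : IsConformal Ω g A) (hgd : MDifferentiable (𝓡 (2 * d)) (𝓡 (2 * d)) g)
    {u v : TangentSpace (𝓡 (2 * d)) y} {n : ℕ} {z ξ η : ℕ → EuclideanSpace ℝ (Fin (2 * d))}
    (hz : Tendsto z atTop (𝓝 0)) (hξ : Tendsto ξ atTop (𝓝 0)) (hη : Tendsto η atTop (𝓝 0))
    (hzt : ∀ j, z j ∈ centeredTarget (EuclideanSpace ℝ (Fin (2 * d))) x)
    (hy : ∀ j, g^[j + n] y = centeredSymm x (z j))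
    (hu : ∀ j, (mfderiv (𝓡 (2 * d)) (𝓡 (2 * d)) g^[j + n] y u : EuclideanSpace ℝ (Fin (2 * d))) =
      b ^ j • (mfderiv (𝓡 (2 * d)) (𝓡 (2 * d)) (centeredSymm x) (z j) (ξ j) :
        EuclideanSpace ℝ (Fin (2 * d))))
    (hv : ∀ j, (mfderiv (𝓡 (2 * d)) (𝓡 (2 * d)) g^[j + n] y v : EuclideanSpace ℝ (Fin (2 * d))) =
      b ^ j • (mfderiv (𝓡 (2 * d)) (𝓡 (2 * d)) (centeredSymm x) (z j) (η j) :
        EuclideanSpace ℝ (Fin (2 * d)))) :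
    Ω.form y ![u, v] = 0 := by
  have hA0 : 0 < A := (pow_pos hb0 2).trans hbA
  let C : ℕ → EuclideanSpace ℝ (Fin (2 * d)) [⋀^Fin 2]→L[ℝ] ℝ := fun j =>
    chartForm Ω.form x (z j + extChartAt (𝓡 (2 * d)) x x)
  have hC : Tendsto C atTop (𝓝 (chartForm Ω.form x (extChartAt (𝓡 (2 * d)) x x))) := by
    refine (continuousAt_chartForm x).tendsto.comp ?_
    simpa using hz.add_const (extChartAt (𝓡 (2 * d)) x x)
  have hzero : Tendsto (fun j => C j ![ξ j, η j]) atTop (𝓝 0) := by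
    have h1 := hC.norm.mul (hξ.norm.mul hη.norm)
    rw [norm_zero, mul_zero, mul_zero] at h1
    refine squeeze_zero_norm (fun j => ?_) h1
    have h2 := (C j).le_opNorm ![ξ j, η j]
    rwa [Fin.prod_univ_two] at h2
  -- A constant equals a sequence tending to zero: `A ^ (j + n)` comes from conformality, and each
  -- of the two arguments contributes `b ^ j`.
  have hkey : ∀ j, Ω.form y ![u, v] = (A ^ n)⁻¹ * ((b ^ 2 / A) ^ j * C j ![ξ j, η j]) := by
    intro j
    have h1 := hg.iterate hgd (j + n) y u v
    have h2 := chartForm_apply_centered (Ω := Ω) (x := x) (z := z j) (ξ j) (η j)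
      (((contMDiffOn_extChartAt_symm (n := 1) (I := 𝓡 (2 * d)) x).contMDiffAt
        ((isOpen_extChartAt_target x).mem_nhds (hzt j))).mdifferentiableAt one_ne_zero)
    have h3 := h1.symm.trans (form_congr_smul (hy j) (hu j) (hv j))
    rw [h2] at h3
    rw [pow_add] at h3
    change _ = _ * C j ![ξ j, η j] at h3
    rw [div_pow, ← pow_mul, mul_comm 2 j, pow_mul]
    field_simp
    linarith
  have hr : Tendsto (fun j => (b ^ 2 / A) ^ j) atTop (𝓝 0) :=
    tendsto_pow_atTop_nhds_zero_of_lt_one (by positivity) ((div_lt_one hA0).2 hbA)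
  have h1 := (hr.mul hzero).const_mul (A ^ n)⁻¹
  rw [mul_zero, mul_zero] at h1
  exact tendsto_nhds_unique (tendsto_const_nhds.congr hkey) h1

section Stable

variable [Bundle.RiemannianBundle (fun x : M => TangentSpace (𝓡 (2 * d)) x)]

lemma image_fastStableSet {g g' : M → M} (hl : Function.LeftInverse g' g)
    (hri : Function.RightInverse g' g) (x : M) {b : ℝ} (hb : 0 < b) :
    g '' fastStableSet (EuclideanSpace ℝ (Fin (2 * d))) g x b =
      fastStableSet (EuclideanSpace ℝ (Fin (2 * d))) g x b ∧
    g' '' fastStableSet (EuclideanSpace ℝ (Fin (2 * d))) g x b =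
      fastStableSet (EuclideanSpace ℝ (Fin (2 * d))) g x b := by
  have h1 : g ⁻¹' fastStableSet (EuclideanSpace ℝ (Fin (2 * d))) g x b =
      fastStableSet (EuclideanSpace ℝ (Fin (2 * d))) g x b :=
    Set.ext fun y => mem_fastStableSet_apply_iff hb
  constructor
  · conv_lhs => rw [← h1]
    exact Set.image_preimage_eq _ hri.surjective
  · rw [Set.image_eq_preimage_of_inverse hri hl, h1]

variable [T2Space M] [IsManifold (𝓡 (2 * d)) 1 M]
  [IsContinuousRiemannianBundle (EuclideanSpace ℝ (Fin (2 * d)))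
    (fun x : M => TangentSpace (𝓡 (2 * d)) x)]

theorem isIsotropicImmersedSubmanifold_fastStableSet {r : ℕ∞} (hr : 1 ≤ r)
    [IsManifold (𝓡 (2 * d)) r M] {g g' : M → M} (hg : ContMDiff (𝓡 (2 * d)) (𝓡 (2 * d)) r g)
    (hg' : ContMDiff (𝓡 (2 * d)) (𝓡 (2 * d)) r g')
    (hl : Function.LeftInverse g' g) (hri : Function.RightInverse g' g) {x : M} (hx : g x = x)
    {b A : ℝ} (hb0 : 0 < b) (hb1 : b < 1) (hbA : b ^ 2 < A) (hgA : IsConformal Ω g A)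
    (hspec : ∀ l ∈ fixedPointSpectrum d g x, ‖l‖ ≠ b) :
    IsIsotropicImmersedSubmanifold d Ω r
      (fastStableSet (EuclideanSpace ℝ (Fin (2 * d))) g x b) := by
  have hr0 : (r : ℕ∞ω) ≠ 0 := by
    have : r ≠ 0 := (zero_lt_one.trans_le hr).ne'
    exact_mod_cast this
  obtain ⟨k, N, tN, cN, ι, hT2, hsc, hman, himm, hinj, hran, hp⟩ :=
    exists_immersion_fastStableSet hr hg hg' hl hri hx hb0 hb1
      (mfderiv (𝓡 (2 * d)) (𝓡 (2 * d)) g x :) rfl (fun z hz h1 => by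
        refine hspec _ (mem_spectrum_baseChange_of_isRoot_charpoly hb0.ne' hz) ?_
        rw [norm_mul, h1, mul_one, Complex.norm_real, Real.norm_of_nonneg hb0.le])
  refine ⟨k, N, tN, cN, ι, hT2, hsc, hman, himm, hinj, hran, fun p u v => ?_⟩
  obtain ⟨n, z, L, hz, hL, hzt, h⟩ := hp p
  exact form_eq_zero_of_contracted hb0 hbA hgA (hg.mdifferentiable hr0) hz (hL u) (hL v) hzt
    (fun j => (h j).1) (fun j => (h j).2 u) (fun j => (h j).2 v)

end Stable

end Conformal

end ConformallySymplectic

end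

noncomputable section

namespace ConformallySymplectic


/-! ### The differential of the inverse at a fixed point. -/

section FixedPoint

universe u
variable {d : ℕ} {M : Type u} [TopologicalSpace M] [ChartedSpace (EuclideanSpace ℝ (Fin (2 * d))) M]

lemma mfderiv_comp_mfderiv_of_leftInverse {g g' : M → M}
    (hg : MDifferentiable (𝓡 (2 * d)) (𝓡 (2 * d)) g)
    (hg' : MDifferentiable (𝓡 (2 * d)) (𝓡 (2 * d)) g')
    (hl : Function.LeftInverse g' g) {x : M} (hx : g x = x)
    (u : EuclideanSpace ℝ (Fin (2 * d))) :
    (mfderiv (𝓡 (2 * d)) (𝓡 (2 * d)) g' x (mfderiv (𝓡 (2 * d)) (𝓡 (2 * d)) g x u) :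
      EuclideanSpace ℝ (Fin (2 * d))) = u := by
  have h := mfderiv_comp x (hg' (g x)) (hg x)
  rw [hl.comp_eq_id, mfderiv_id, hx] at h
  exact (DFunLike.congr_fun h u).symm

lemma inv_mem_fixedPointSpectrum {g g' : M → M}
    (hg : MDifferentiable (𝓡 (2 * d)) (𝓡 (2 * d)) g)
    (hg' : MDifferentiable (𝓡 (2 * d)) (𝓡 (2 * d)) g')
    (hl : Function.LeftInverse g' g) (hri : Function.RightInverse g' g) {x : M} (hx : g x = x)
    {l : ℂ} (hl0 : l ≠ 0) (h : l ∈ fixedPointSpectrum d g x) :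
    l⁻¹ ∈ fixedPointSpectrum d g' x := by
  have hx' : g' x = x := by
    conv_lhs => rw [← hx]
    exact hl x
  exact inv_mem_spectrum_baseChange
    (LinearMap.ext fun u => mfderiv_comp_mfderiv_of_leftInverse hg' hg hri hx' u)
    (LinearMap.ext fun u => mfderiv_comp_mfderiv_of_leftInverse hg hg' hl hx u) hl0 h

end FixedPoint

end ConformallySymplectic

end

/-! ### The theorem, with the stable set result applied to `f^[m]` and to its inverse. -/

theorem mainTheorem4 {d : ℕ} {M : Type*} [TopologicalSpace M] [T2Space M]
    [SecondCountableTopology M] [ChartedSpace (EuclideanSpace ℝ (Fin (2 * d))) M]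
    [IsManifold (𝓡 (2 * d)) ∞ M]
    [Bundle.RiemannianBundle (fun x : M => TangentSpace (𝓡 (2 * d)) x)]
    [IsContinuousRiemannianBundle (EuclideanSpace ℝ (Fin (2 * d)))
      (fun x : M => TangentSpace (𝓡 (2 * d)) x)]
    (Ω : ConformallySymplectic.SymplecticForm d M)
    (r : ℕ∞) (hr : 1 ≤ r)
    (f : Diffeomorph (𝓡 (2 * d)) (𝓡 (2 * d)) M M r)
    (a : ℝ) (ha : a ∈ Set.Ioo (0 : ℝ) 1) (hf : ConformallySymplectic.IsConformal Ω f a)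
    (m : ℕ) (hm : 1 ≤ m) (x : M) (hx : Function.IsPeriodicPt f m x)
    (Λminus Λplus : Set ℂ)
    (hΛminus : Λminus = {l ∈ ConformallySymplectic.fixedPointSpectrum d (f^[m]) x |
      ‖l‖ < Real.sqrt (a ^ m)})
    (hΛplus : Λplus = {l ∈ ConformallySymplectic.fixedPointSpectrum d (f^[m]) x | 1 < ‖l‖})
    (b c : ℝ)
    (hb0 : 0 < b) (hb : ∀ l ∈ Λminus, ‖l‖ < b) (hba : b < Real.sqrt (a ^ m))
    (hc1 : 1 < c) (hc : ∀ l ∈ Λplus, c < ‖l‖) :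
    (ConformallySymplectic.IsIsotropicImmersedSubmanifold d Ω r
        (ConformallySymplectic.strongStableSet d f m x b) ∧
      f^[m] '' ConformallySymplectic.strongStableSet d f m x b =
        ConformallySymplectic.strongStableSet d f m x b) ∧
    (ConformallySymplectic.IsIsotropicImmersedSubmanifold d Ω r
        (ConformallySymplectic.unstableSet d f.symm m x c) ∧
      f^[m] '' ConformallySymplectic.unstableSet d f.symm m x c =
        ConformallySymplectic.unstableSet d f.symm m x c) := by
  have hr0 : (r : ℕ∞ω) ≠ 0 := by
    have : r ≠ 0 := (zero_lt_one.trans_le hr).ne'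
    exact_mod_cast this
  have : IsManifold (𝓡 (2 * d)) 1 M := IsManifold.of_le (n := ∞) (by exact_mod_cast le_top)
  have : IsManifold (𝓡 (2 * d)) r M := IsManifold.of_le (n := ∞) (by exact_mod_cast le_top)
  have hg : ContMDiff (𝓡 (2 * d)) (𝓡 (2 * d)) r f^[m] :=
    ConformallySymplectic.contMDiff_iterate f.contMDiff m
  have hg' : ContMDiff (𝓡 (2 * d)) (𝓡 (2 * d)) r f.symm^[m] :=
    ConformallySymplectic.contMDiff_iterate f.symm.contMDiff m
  have hl : Function.LeftInverse f.symm^[m] f^[m] :=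
    Function.LeftInverse.iterate f.symm_apply_apply m
  have hri : Function.RightInverse f.symm^[m] f^[m] :=
    Function.LeftInverse.iterate f.apply_symm_apply m
  have hgx : f^[m] x = x := hx
  have hgx' : f.symm^[m] x = x := by
    conv_lhs => rw [← hgx]
    exact hl x
  have ha0 : 0 < a ^ m := pow_pos ha.1 m
  have ha1 : a ^ m < 1 := pow_lt_one₀ ha.1.le ha.2 (by omega)
  have hgA := hf.iterate (f.contMDiff.mdifferentiable hr0) m
  have hgA' := hgA.of_rightInverse ha0.ne' (hg.mdifferentiable hr0) (hg'.mdifferentiable hr0) hri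
  have hminus : ConformallySymplectic.strongStableSet d f m x b =
      ConformallySymplectic.fastStableSet (EuclideanSpace ℝ (Fin (2 * d))) f^[m] x b := by
    ext y
    simp only [ConformallySymplectic.strongStableSet, ConformallySymplectic.fastStableSet,
      Function.iterate_mul, Function.iterate_fixed hgx]
  have hplus : ConformallySymplectic.unstableSet d f.symm m x c =
      ConformallySymplectic.fastStableSet (EuclideanSpace ℝ (Fin (2 * d))) f.symm^[m] x c⁻¹ := by
    ext y
    simp only [ConformallySymplectic.unstableSet, ConformallySymplectic.fastStableSet,
      Function.iterate_mul, Function.iterate_fixed hgx', inv_pow, one_div, inv_inv]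
    simp only [Manifold.riemannianEDist_comm (x := x)]
  have hb2 : b ^ 2 < a ^ m := by
    have h := pow_lt_pow_left₀ hba hb0.le two_ne_zero
    rwa [Real.sq_sqrt ha0.le] at h
  have hc0 : 0 < c⁻¹ := inv_pos.2 (zero_lt_one.trans hc1)
  have hc1' : c⁻¹ < 1 := inv_lt_one_of_one_lt₀ hc1
  rw [hminus, hplus]
  refine ⟨⟨?_, (ConformallySymplectic.image_fastStableSet hl hri x hb0).1⟩, ?_,
    (ConformallySymplectic.image_fastStableSet hri hl x hc0).2⟩
  · refine ConformallySymplectic.isIsotropicImmersedSubmanifold_fastStableSet hr hg hg' hl hri hgx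
      hb0 ?_ hb2 hgA fun l hls hlb => ?_
    · exact (pow_lt_one_iff_of_nonneg hb0.le two_ne_zero).1 (hb2.trans ha1)
    -- A multiplier of modulus `b` is below `√(a^m)`, hence in `Λminus`, hence of modulus strictly
    -- below `b`.
    · have h := hb l (by rw [hΛminus]; exact ⟨hls, by rwa [hlb]⟩)
      exact h.ne hlb
  · refine ConformallySymplectic.isIsotropicImmersedSubmanifold_fastStableSet hr hg' hg hri hl hgx'
      hc0 hc1' ?_ hgA' fun l hls hlc => ?_
    · exact (pow_lt_one₀ hc0.le hc1' two_ne_zero).trans ((one_lt_inv₀ ha0).2 ha1)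
    -- A multiplier of the inverse of modulus `1/c` gives a multiplier of `f^[m]` of modulus `c >
    -- 1`, which contradicts the strict bound on `Λplus`.
    · have hl0 : l ≠ 0 := norm_pos_iff.1 (hlc ▸ hc0)
      have hlinv : ‖l⁻¹‖ = c := by rw [norm_inv, hlc, inv_inv]
      have h := hc l⁻¹ (by
        rw [hΛplus]
        refine ⟨ConformallySymplectic.inv_mem_fixedPointSpectrum (hg'.mdifferentiable hr0)
          (hg.mdifferentiable hr0) hri hl hgx' hl0 hls, ?_⟩
        rwa [hlinv])
      exact h.ne' hlinv
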